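/- Let $\partial\Delta^3$ be the boundary of the tetrahedron, as a simplicial set, let $\beta$ be a normalized $2$-cocycle on $\partial\Delta^3$ with values in $\mathbb{Z}_2=\mathbb{Z}/2$, and let $[\beta]\in H^2(\partial\Delta^3;\mathbb{Z}_2)\cong\mathbb{Z}_2$ be its class; thus $[\beta]=1$ means that $[\beta]$ is non-zero. Let $\pi:N\mathbb{Z}_2\times_\beta\partial\Delta^3\to\partial\Delta^3$ be the twisted product with the nerve $N\mathbb{Z}_2$, whose faces in dimension $2$ are $d_0((a,b),\sigma)=(b+\beta(\sigma),d_0\sigma)$, $d_1((a,b),\sigma)=(a+b,d_1\sigma)$, $d_2((a,b),\sigma)=(a,d_2\sigma)$. For a simplicial set $Y$ let $D(Y)$ be the simplicial set of finitely supported probability distributions on the simplices of $Y$, and let $\delta:Y\to D(Y)$ send a simplex to the delta distribution at it. A $\beta$-twisted distribution is a simplicial map $p:\partial\Delta^3\to D(N\mathbb{Z}_2\times_\beta\partial\Delta^3)$ with $D(\pi)\circ p=\delta$; it is deterministic if $p=\delta\circ s$ for a section $s$ of $\pi$. These distributions form a convex polytope $\mathrm{sDist}_\beta(\partial\Delta^3)$,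 whose vertices are its extreme points. For such $p$, let $Z_p\subset\partial\Delta^3$ be the simplicial subset generated by the non-degenerate edges and triangles $x$ at which $p_x$ is a delta distribution, and let $(Z_p)_n^\circ$ be its set of non-degenerate $n$-simplices. Then: 1. For every $p\in\mathrm{sDist}_\beta(\partial\Delta^3)$ one has $|(Z_p)_2^\circ|\in\{0,1,4\}$, and $|(Z_p)_2^\circ|=4$ if and only if $p$ is deterministic. 2. If $p$ is a vertex, then $|(Z_p)_1^\circ|-|(Z_p)_2^\circ|\ge 2$. 3. If $|(Z_p)_2^\circ|=0$ and $|(Z_p)_1^\circ|\ge 2$, then $p$ is a vertex if and only if $[\beta]=1$. 4. If $|(Z_p)_2^\circ|=1$, then $p$ is a vertex if and only if $[\beta]=1$. 5. If $[\beta]=0$, then every vertex of $\mathrm{sDist}_\beta(\partial\Delta^3)$ is deterministic. -/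

import Mathlib

open CategoryTheory Simplicial Opposite
open scoped BigOperators

universe u

noncomputable section

namespace SDist

/-! ### Cochains and cohomology with coefficients in `ℤ/2` -/

/-- The coboundary map `Cⁿ(X) → Cⁿ⁺¹(X)`, where `Cⁿ(X)` is the group of functions `Xₙ → ℤ/2`. -/
def coboundary (X : SSet.{u}) (n : ℕ) :
    (X _⦋n⦌ → ZMod 2) →ₗ[ZMod 2] (X _⦋n + 1⦌ → ZMod 2) where
  toFun α := fun x => ∑ i : Fin (n + 2), (-1 : ZMod 2) ^ (i : ℕ) * α (X.δ i x)
  map_add' α α' := by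
    funext x
    simp [mul_add, Finset.sum_add_distrib]
  map_smul' c α := by
    funext x
    simp [Finset.mul_sum, mul_left_comm]

/-- The second cohomology group `H²(X)` with coefficients in `ℤ/2`: cocycles modulo
coboundaries. -/
abbrev H2 (X : SSet.{u}) : Type u :=
  LinearMap.ker (coboundary X 2) ⧸
    (LinearMap.range (coboundary X 1)).submoduleOf (LinearMap.ker (coboundary X 2))

/-- A normalized `2`-cocycle on `X` with values in `ℤ/2`. -/
structure NormalizedCocycle (X : SSet.{u}) where
  /-- The underlying cochain. -/
  toFun : X _⦋2⦌ → ZMod 2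
  cocycle : coboundary X 2 toFun = 0
  normalized : ∀ σ ∈ X.degenerate 2, toFun σ = 0

instance (X : SSet.{u}) : CoeFun (NormalizedCocycle X) (fun _ => X _⦋2⦌ → ZMod 2) :=
  ⟨NormalizedCocycle.toFun⟩

/-- The cohomology class `[β] ∈ H²(X)`. -/
def NormalizedCocycle.cls {X : SSet.{u}} (β : NormalizedCocycle X) : H2 X :=
  Submodule.Quotient.mk ⟨β.toFun, LinearMap.mem_ker.2 β.cocycle⟩

/-! ### The twisted product `Nℤ₂ ×_β X` -/

/-- The partial sum `a₁ + ⋯ + aⱼ`, i.e. the label of the edge `0 → j` in the simplex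
`(a₁, …, aₙ)` of the nerve `Nℤ₂`. -/
def partialSum {n : ℕ} (a : Fin n → ZMod 2) (j : Fin (n + 1)) : ZMod 2 :=
  ∑ k : Fin n, if k.castSucc < j then a k else 0

/-- The label in `ℤ/2` of the edge `i → j` of the simplex `((a₁, …, aₙ), x)` of the twisted
product. It is the label `aᵢ₊₁ + ⋯ + aⱼ` of that edge in the nerve, corrected by the value of `β`
on the face of `x` with vertices `0, i, j`. -/
def edgeLabel {X : SSet.{u}} (β : NormalizedCocycle X) {n : SimplexCategory}
    (a : Fin n.len → ZMod 2) (x : X.obj (op n)) (i j : Fin (n.len + 1)) (h : i ≤ j) : ZMod 2 :=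
  partialSum a i + partialSum a j +
    β (X.map (SimplexCategory.mkOfLeComp (n := n.len) 0 i j (Fin.zero_le i) h).op x)

lemma partialSum_zero {n : ℕ} (a : Fin n → ZMod 2) : partialSum a 0 = 0 := by
  simp [partialSum]

lemma partialSum_succ_sub {n : ℕ} (a : Fin n → ZMod 2) (k : Fin n) :
    partialSum a k.succ - partialSum a k.castSucc = a k := by
  rw [partialSum, partialSum, ← Finset.sum_sub_distrib, Finset.sum_eq_single k]
  · simp
  · intro b _ hb
    have : b.castSucc < k.succ ↔ b.castSucc < k.castSucc := by
      simp only [Fin.lt_def, Fin.val_castSucc, Fin.val_succ]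
      have : (b : ℕ) ≠ k := fun h => hb (Fin.ext h)
      omega
    simp [this]
  · simp

/-- Partial sums telescope. -/
lemma partialSum_sub {n : ℕ} (f : Fin (n + 1) → ZMod 2) (j : Fin (n + 1)) :
    partialSum (fun k : Fin n => f k.succ - f k.castSucc) j = f j - f 0 := by
  induction j using Fin.induction with
  | zero => simp [partialSum]
  | succ k ih =>
    have := partialSum_succ_sub (fun k : Fin n => f k.succ - f k.castSucc) k
    rw [sub_eq_iff_eq_add] at this
    rw [this, ih]
    ring

lemma mkOfLeComp_comp {m n : SimplexCategory} (θ : m ⟶ n) (i j k : Fin (m.len + 1))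
    (h₁ : i ≤ j) (h₂ : j ≤ k) :
    SimplexCategory.mkOfLeComp (n := m.len) i j k h₁ h₂ ≫ θ =
      SimplexCategory.mkOfLeComp (n := n.len) (θ.toOrderHom i) (θ.toOrderHom j) (θ.toOrderHom k)
        (θ.toOrderHom.monotone h₁) (θ.toOrderHom.monotone h₂) := by
  ext l
  fin_cases l <;> rfl

lemma beta_degenerate {X : SSet.{u}} (β : NormalizedCocycle X) {n : SimplexCategory}
    (x : X.obj (op n)) (i j k : Fin (n.len + 1)) (h₁ : i ≤ j) (h₂ : j ≤ k) (h : i = j ∨ j = k) :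
    β (X.map (SimplexCategory.mkOfLeComp (n := n.len) i j k h₁ h₂).op x) = 0 := by
  apply β.normalized
  rcases h with rfl | rfl
  · have : SimplexCategory.mkOfLeComp (n := n.len) i i k h₁ h₂ =
        SimplexCategory.σ 0 ≫ SimplexCategory.δ 1 ≫
          SimplexCategory.mkOfLeComp (n := n.len) i i k h₁ h₂ := by
      ext l
      fin_cases l <;> rfl
    rw [this, op_comp, Functor.map_comp]
    exact SSet.σ_mem_degenerate X 0 _
  · have : SimplexCategory.mkOfLeComp (n := n.len) i j j h₁ h₂ =
        SimplexCategory.σ 1 ≫ SimplexCategory.δ 2 ≫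
          SimplexCategory.mkOfLeComp (n := n.len) i j j h₁ h₂ := by
      ext l
      fin_cases l <;> rfl
    rw [this, op_comp, Functor.map_comp]
    exact SSet.σ_mem_degenerate X 1 _

/-- The labels on the edges of a simplex of the twisted product form a cochain whose coboundary
is `β`. -/
lemma edgeLabel_cocycle {X : SSet.{u}} (β : NormalizedCocycle X) {n : SimplexCategory}
    (a : Fin n.len → ZMod 2) (x : X.obj (op n)) (i j k : Fin (n.len + 1))
    (h₁ : i ≤ j) (h₂ : j ≤ k) :
    edgeLabel β a x i j h₁ + edgeLabel β a x i k (h₁.trans h₂) +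
        β (X.map (SimplexCategory.mkOfLeComp (n := n.len) i j k h₁ h₂).op x) =
      edgeLabel β a x j k h₂ := by
  let f : ⦋3⦌ ⟶ ⦋n.len⦌ := SimplexCategory.mkHom
    { toFun := ![0, i, j, k]
      monotone' := by
        rw [Fin.monotone_iff_le_succ]
        intro l
        fin_cases l
        · exact Fin.zero_le i
        · exact h₁
        · exact h₂ }
  have hc : ∑ l : Fin 4, (-1 : ZMod 2) ^ (l : ℕ) * β (X.δ (n := 2) l (X.map f.op x)) = 0 :=
    congrFun β.cocycle (X.map f.op x)
  have key : ∀ (l : Fin 4) (p q r : Fin (n.len + 1)) (hp : p ≤ q) (hq : q ≤ r),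
      SimplexCategory.δ l ≫ f = SimplexCategory.mkOfLeComp (n := n.len) p q r hp hq →
      X.δ l (X.map f.op x) =
        X.map (SimplexCategory.mkOfLeComp (n := n.len) p q r hp hq).op x := by
    intro l p q r hp hq h
    rw [← h, op_comp, Functor.map_comp]
    rfl
  have e0 := key 0 i j k h₁ h₂ (by ext l; fin_cases l <;> rfl)
  have e1 := key 1 0 j k (Fin.zero_le j) h₂ (by ext l; fin_cases l <;> rfl)
  have e2 := key 2 0 i k (Fin.zero_le i) (h₁.trans h₂) (by ext l; fin_cases l <;> rfl)
  have e3 := key 3 0 i j (Fin.zero_le i) h₁ (by ext l; fin_cases l <;> rfl)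
  rw [Fin.sum_univ_four, e0, e1, e2, e3] at hc
  simp only [edgeLabel]
  have two : ∀ z : ZMod 2, z + z = 0 := by decide
  have neg : (-1 : ZMod 2) = 1 := by decide
  simp only [neg, one_pow, one_mul] at hc
  generalize partialSum a i = A, partialSum a j = B, partialSum a k = C at *
  generalize β (X.map (SimplexCategory.mkOfLeComp (n := n.len) i j k _ _).op x) = b0 at *
  generalize β (X.map (SimplexCategory.mkOfLeComp (n := n.len) 0 j k _ _).op x) = b1 at *
  generalize β (X.map (SimplexCategory.mkOfLeComp (n := n.len) 0 i k _ _).op x) = b2 at *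
  generalize β (X.map (SimplexCategory.mkOfLeComp (n := n.len) 0 i j _ _).op x) = b3 at *
  revert hc
  clear * -
  revert A B C b0 b1 b2 b3
  decide

lemma edgeLabel_self {X : SSet.{u}} (β : NormalizedCocycle X) {n : SimplexCategory}
    (a : Fin n.len → ZMod 2) (x : X.obj (op n)) (i : Fin (n.len + 1)) :
    edgeLabel β a x i i le_rfl = 0 := by
  have two : ∀ z : ZMod 2, z + z = 0 := by decide
  rw [edgeLabel, beta_degenerate β x 0 i i _ _ (Or.inr rfl), two, add_zero]

lemma edgeLabel_zero {X : SSet.{u}} (β : NormalizedCocycle X) {n : SimplexCategory}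
    (a : Fin n.len → ZMod 2) (x : X.obj (op n)) (i : Fin (n.len + 1)) :
    edgeLabel β a x 0 i (Fin.zero_le i) = partialSum a i := by
  rw [edgeLabel, beta_degenerate β x 0 0 i _ _ (Or.inl rfl), partialSum_zero, zero_add, add_zero]

/-- The action of `θ : [m] → [n]` on the fibre coordinates of a simplex `((a₁, …, aₙ), x)` of the
twisted product: the `k`-th new coordinate is the difference of the labels of the edges
`θ(0) → θ(k)` and `θ(0) → θ(k - 1)`. -/
def twistedCoord {X : SSet.{u}} (β : NormalizedCocycle X) {m n : SimplexCategory} (θ : m ⟶ n)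
    (a : Fin n.len → ZMod 2) (x : X.obj (op n)) : Fin m.len → ZMod 2 := fun k =>
  edgeLabel β a x (θ.toOrderHom 0) (θ.toOrderHom k.succ) (θ.toOrderHom.monotone (Fin.zero_le _)) -
  edgeLabel β a x (θ.toOrderHom 0) (θ.toOrderHom k.castSucc)
    (θ.toOrderHom.monotone (Fin.zero_le _))

lemma partialSum_twistedCoord {X : SSet.{u}} (β : NormalizedCocycle X) {m n : SimplexCategory}
    (θ : m ⟶ n) (a : Fin n.len → ZMod 2) (x : X.obj (op n)) (j : Fin (m.len + 1)) :
    partialSum (twistedCoord β θ a x) j =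
      edgeLabel β a x (θ.toOrderHom 0) (θ.toOrderHom j)
        (θ.toOrderHom.monotone (Fin.zero_le _)) := by
  have := partialSum_sub (fun j : Fin (m.len + 1) => edgeLabel β a x (θ.toOrderHom 0)
    (θ.toOrderHom j) (θ.toOrderHom.monotone (Fin.zero_le _))) j
  rw [edgeLabel_self, sub_zero] at this
  exact this

lemma edgeLabel_twistedCoord {X : SSet.{u}} (β : NormalizedCocycle X) {m n : SimplexCategory}
    (θ : m ⟶ n) (a : Fin n.len → ZMod 2) (x : X.obj (op n)) (i j : Fin (m.len + 1)) (h : i ≤ j) :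
    edgeLabel β (twistedCoord β θ a x) (X.map θ.op x) i j h =
      edgeLabel β a x (θ.toOrderHom i) (θ.toOrderHom j) (θ.toOrderHom.monotone h) := by
  rw [edgeLabel, partialSum_twistedCoord, partialSum_twistedCoord,
    ← edgeLabel_cocycle β a x (θ.toOrderHom 0) (θ.toOrderHom i) (θ.toOrderHom j)
      (θ.toOrderHom.monotone (Fin.zero_le _)) (θ.toOrderHom.monotone h),
    ← mkOfLeComp_comp θ 0 i j (Fin.zero_le i) h, op_comp, Functor.map_comp]
  rfl

lemma twistedCoord_id {X : SSet.{u}} (β : NormalizedCocycle X) {n : SimplexCategory}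
    (a : Fin n.len → ZMod 2) (x : X.obj (op n)) : twistedCoord β (𝟙 n) a x = a := by
  funext k
  have h0 := edgeLabel_zero β a x k.succ
  have h1 := edgeLabel_zero β a x k.castSucc
  have : twistedCoord β (𝟙 n) a x k =
    edgeLabel β a x 0 k.succ (Fin.zero_le _) - edgeLabel β a x 0 k.castSucc (Fin.zero_le _) := rfl
  rw [this, h0, h1, partialSum_succ_sub]

lemma twistedCoord_comp {X : SSet.{u}} (β : NormalizedCocycle X) {l m n : SimplexCategory}
    (η : l ⟶ m) (θ : m ⟶ n) (a : Fin n.len → ZMod 2) (x : X.obj (op n)) :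
    twistedCoord β (η ≫ θ) a x = twistedCoord β η (twistedCoord β θ a x) (X.map θ.op x) := by
  funext k
  conv_rhs => rw [twistedCoord, edgeLabel_twistedCoord, edgeLabel_twistedCoord]
  rfl

/-- The twisted product `Nℤ₂ ×_β X`. Its `n`-simplices are the pairs `((a₁, …, aₙ), x)` with
`(a₁, …, aₙ)` an `n`-simplex of `Nℤ₂` and `x` an `n`-simplex of `X`; only the `d₀`-faces are
twisted. -/
def twistedProduct {X : SSet.{u}} (β : NormalizedCocycle X) : SSet.{u} where
  obj n := (Fin n.unop.len → ZMod 2) × X.obj n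
  map θ := ↾fun e => (twistedCoord β θ.unop e.1 e.2, X.map θ e.2)
  map_id n := by
    refine ConcreteCategory.hom_ext _ _ fun e => ?_
    exact Prod.ext (twistedCoord_id β (n := n.unop) e.1 e.2)
      (ConcreteCategory.congr_hom (X.map_id n) e.2)
  map_comp f g := by
    refine ConcreteCategory.hom_ext _ _ fun e => ?_
    exact Prod.ext (twistedCoord_comp β g.unop f.unop e.1 e.2)
      (ConcreteCategory.congr_hom (X.map_comp f g) e.2)

/-- The projection `π : Nℤ₂ ×_β X → X`. -/
def twistedProj {X : SSet.{u}} (β : NormalizedCocycle X) : twistedProduct β ⟶ X where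
  app _ := ↾fun e => e.2
  naturality _ _ _ := rfl

/-- The face maps of the twisted product in dimension `2`. -/
lemma twistedProduct_face {X : SSet.{u}} (β : NormalizedCocycle X) (a b : ZMod 2)
    (σ : X _⦋2⦌) :
    (twistedProduct β).δ 0 (show (twistedProduct β) _⦋2⦌ from (![a, b], σ)) =
        (![b + β σ], X.δ 0 σ) ∧
      (twistedProduct β).δ 1 (show (twistedProduct β) _⦋2⦌ from (![a, b], σ)) =
        (![a + b], X.δ 1 σ) ∧
      (twistedProduct β).δ 2 (show (twistedProduct β) _⦋2⦌ from (![a, b], σ)) =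
        (![a], X.δ 2 σ) := by
  have h01 := edgeLabel_zero β (n := ⦋2⦌) ![a, b] σ 1
  have h02 := edgeLabel_zero β (n := ⦋2⦌) ![a, b] σ 2
  have h00 := edgeLabel_self β (n := ⦋2⦌) ![a, b] σ 0
  have h11 := edgeLabel_self β (n := ⦋2⦌) ![a, b] σ 1
  have h12 := edgeLabel_cocycle β (n := ⦋2⦌) ![a, b] σ 0 1 2 (by decide) (by decide)
  have hid : SimplexCategory.mkOfLeComp (n := 2) 0 1 2 (by decide) (by decide) = 𝟙 ⦋2⦌ := by
    ext l
    fin_cases l <;> rfl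
  have hσ : X.map (SimplexCategory.mkOfLeComp (n := 2) 0 1 2 (by decide) (by decide)).op σ = σ := by
    rw [hid]
    exact ConcreteCategory.congr_hom (X.map_id (op ⦋2⦌)) σ
  have two : ∀ z w : ZMod 2, z + (z + w) = w := by decide
  have p1 : partialSum (n := 2) ![a, b] 1 = a := by
    simp [partialSum]
  have p2 : partialSum (n := 2) ![a, b] 2 = a + b := by
    simp [partialSum, Fin.sum_univ_two, Fin.lt_def]
  have e12 : edgeLabel β (n := ⦋2⦌) ![a, b] σ 1 2 (by decide) = b + β σ := by
    rw [← h12]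
    erw [h01, h02, hσ, p1, p2]
    rw [two]
  refine ⟨Prod.ext ?_ rfl, Prod.ext ?_ rfl, Prod.ext ?_ rfl⟩ <;> funext k <;> fin_cases k
  · exact (congrArg₂ (· - ·) e12 h11).trans (sub_zero _)
  · exact (congrArg₂ (· - ·) (h02.trans p2) h00).trans (sub_zero _)
  · exact (congrArg₂ (· - ·) (h01.trans p1) h00).trans (sub_zero _)

/-! ### Simplicial distributions -/

/-- The simplicial set `D(Y)` of finitely supported probability distributions on the simplices
of `Y`. -/
def distSSet (Y : SSet.{u}) : SSet.{u} where
  obj n := Convexity.StdSimplex ℝ (Y.obj n)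
  map θ := ↾fun p => p.map (Y.map θ)
  map_id n := by
    refine ConcreteCategory.hom_ext _ _ fun p => ?_
    refine (congrArg (fun g => p.map g) ?_).trans (Convexity.StdSimplex.map_id p)
    funext y
    exact ConcreteCategory.congr_hom (Y.map_id n) y
  map_comp f g := by
    refine ConcreteCategory.hom_ext _ _ fun p => ?_
    refine (congrArg (fun g => p.map g) ?_).trans
      (Convexity.StdSimplex.map_map p (Y.map f) (Y.map g)).symm
    funext y
    exact ConcreteCategory.congr_hom (Y.map_comp f g) y

/-- The map `D(f) : D(Y) → D(Z)` induced by `f : Y → Z`. -/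
def distMap {Y Z : SSet.{u}} (f : Y ⟶ Z) : distSSet Y ⟶ distSSet Z where
  app n := ↾fun p => p.map (f.app n)
  naturality m n θ := by
    refine ConcreteCategory.hom_ext _ _ fun p => ?_
    refine (Convexity.StdSimplex.map_map p (Y.map θ) (f.app n)).trans
      ((congrArg (fun g => p.map g) ?_).trans
        (Convexity.StdSimplex.map_map p (f.app m) (Z.map θ)).symm)
    funext y
    exact ConcreteCategory.congr_hom (f.naturality θ) y

/-- The map `δ : Y → D(Y)` sending a simplex to the delta distribution peaked at it. -/
def delta (Y : SSet.{u}) : Y ⟶ distSSet Y where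
  app _ := ↾fun y => Convexity.StdSimplex.single y
  naturality m n θ := by
    refine ConcreteCategory.hom_ext _ _ fun y => ?_
    exact (Convexity.StdSimplex.map_single (R := ℝ) y (Y.map θ)).symm

/-- The set `sDist_β(X)` of `β`-twisted distributions: simplicial maps `p : X → D(Nℤ₂ ×_β X)`
with `D(π) ∘ p = δ`. -/
def twistedDist {X : SSet.{u}} (β : NormalizedCocycle X) :
    Set (X ⟶ distSSet (twistedProduct β)) :=
  {p | p ≫ distMap (twistedProj β) = delta X}

/-- `p` is a `β`-twisted deterministic distribution: `p = δ ∘ s` for a section `s` of `π`. -/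
def IsDeterministic {X : SSet.{u}} {β : NormalizedCocycle X}
    (p : X ⟶ distSSet (twistedProduct β)) : Prop :=
  ∃ s : X ⟶ twistedProduct β, s ≫ twistedProj β = 𝟙 X ∧ p = s ≫ delta (twistedProduct β)

/-- The probability `p_x(e)` that the distribution at the simplex `x` assigns to `e`. -/
def prob {X Y : SSet.{u}} (p : X ⟶ distSSet Y) {n : SimplexCategoryᵒᵖ} (x : X.obj n)
    (e : Y.obj n) : ℝ :=
  Convexity.StdSimplex.weights (show Convexity.StdSimplex ℝ (Y.obj n) from p.app n x) e

/-- The probabilities of `p`, as a point of the real vector space in which `sDist_β(X)` is a convex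
set. -/
def coords {X Y : SSet.{u}} (p : X ⟶ distSSet Y) :
    (n : SimplexCategoryᵒᵖ) → X.obj n → Y.obj n → ℝ :=
  fun _ x e => prob p x e

/-- `p` is a vertex (extreme point) of `sDist_β(X)`. -/
def IsVertex {X : SSet.{u}} (β : NormalizedCocycle X)
    (p : X ⟶ distSSet (twistedProduct β)) : Prop :=
  p ∈ twistedDist β ∧ coords p ∈ Set.extremePoints ℝ (coords '' twistedDist β)

/-! ### Deterministic edges and triangles -/

/-- A non-degenerate `n`-simplex `x` such that `p_x` is a delta distribution `δᵃ`,
`a ∈ (ℤ/2)ⁿ`; a deterministic edge for `n = 1`, a deterministic triangle for `n = 2`. -/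
def IsDeterministicSimplex {X : SSet.{u}} {β : NormalizedCocycle X}
    (p : X ⟶ distSSet (twistedProduct β)) {n : ℕ} (x : X _⦋n⦌) : Prop :=
  x ∈ X.nonDegenerate n ∧ ∃ a : Fin n → ZMod 2,
    p.app (op ⦋n⦌) x =
      (delta (twistedProduct β)).app (op ⦋n⦌) (show (twistedProduct β) _⦋n⦌ from (a, x))

/-- The simplicial subset `Z_p` of `X` generated by the deterministic edges and triangles. -/
def detSubcomplex {X : SSet.{u}} {β : NormalizedCocycle X}
    (p : X ⟶ distSSet (twistedProduct β)) : X.Subcomplex :=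
  (⨆ x : {x : X _⦋1⦌ // IsDeterministicSimplex p x}, SSet.Subcomplex.ofSimplex x.1) ⊔
    ⨆ σ : {σ : X _⦋2⦌ // IsDeterministicSimplex p σ}, SSet.Subcomplex.ofSimplex σ.1

/-- The set `(Z_p)ₙ°` of non-degenerate `n`-simplices of `X` that lie in `Z_p`. -/
def detSimplices {X : SSet.{u}} {β : NormalizedCocycle X}
    (p : X ⟶ distSSet (twistedProduct β)) (n : ℕ) : Set (X _⦋n⦌) :=
  {x | x ∈ X.nonDegenerate n ∧ x ∈ (detSubcomplex p).obj (op ⦋n⦌)}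

end SDist

/-!
The proof identifies `sDist_β(∂Δ³)` with an explicit polytope in `ℝ⁶` and reads off its vertices.

A distribution on `ℤ/2` is the same as the expectation `u ∈ [-1, 1]` of the character
`a ↦ (-1)ᵃ`, and by Fourier inversion a distribution on `(ℤ/2)²` is determined by the expectations
of the three non-trivial characters. On a triangle `σ` these are, up to the sign `(-1)^β(σ)`, the
expectations on the three edges (`four_mul_prob`). A twisted distribution is therefore a function
`w` on the six edges such that on each triangle `1 + x u₁ + y u₂ + z u₃ ≥ 0` for all signs `x, y, z`
with product `(-1)^β(σ)` (`Feasible`, `exists_expectations_eq`, `coords_eq_of_expectations`). Here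
the simplicial map with given edge expectations is glued from its four triangles
(`exists_boundary_hom`). Consequently `p` is a vertex if and only if no non-zero displacement
preserves its tight inequalities (`isVertex_iff_isRigid`).

An edge is deterministic if its expectation is `±1`. On a triangle with a deterministic edge, the
expectations on the two other edges agree up to sign (`Feasible.eq_mul`), so two deterministic edges
make a triangle deterministic and two deterministic triangles make everything deterministic. This
gives the possible numbers of triangles.

If at most one edge is deterministic, each triangle has at most one tight inequality, up to a
multiple of the deterministic coordinate; then five linear equations govern displacements in a
space of dimension six, and `p` is not a vertex (`not_isRigid_of_le_one`). In the remaining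
non-deterministic cases, two opposite deterministic edges or one deterministic triangle, the
coordinates of a displacement agree up to sign around a cycle of edges. The product of the signs is
`(-1)^∑ β(σ)`, the sum being over the four triangles. So the displacement must vanish if the
sum is `1`, and there is a non-zero one if it is `0` (`isRigid_iff_of_opposite`,
`isRigid_iff_of_facet`). The sum vanishes if and only if `[β] = 0` (`cls_eq_zero_iff`).
-/

namespace SDist

open Convexity

/-! ### Maps out of the boundary of a simplex -/

/-- The facet of `∂Δ[n + 1]` opposite to the vertex `d`. -/
def facet {n : ℕ} (d : Fin (n + 2)) : (∂Δ[n + 1] : SSet.{u}) _⦋n⦌ :=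
  SSet.yonedaEquiv (SSet.boundary.ι d)

/-- Every simplex of `∂Δ[n + 1]` lies on a facet. -/
lemma exists_eq_map_facet {n : ℕ} {m : SimplexCategoryᵒᵖ}
    (x : (∂Δ[n + 1] : SSet.{u}).obj m) :
    ∃ (d : Fin (n + 2)) (θ : m.unop ⟶ ⦋n⦌), x = (∂Δ[n + 1] : SSet.{u}).map θ.op (facet d) := by
  obtain ⟨x, hx⟩ := x
  simp only [SSet.boundary_eq_iSup, SSet.stdSimplex.face_singleton_compl, Subfunctor.iSup_obj,
    Set.mem_iUnion, SSet.Subcomplex.mem_ofSimplex_obj_iff] at hx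
  obtain ⟨d, θ, rfl⟩ := hx
  exact ⟨d, θ, rfl⟩

/-- A map out of `∂Δ[n + 1]` is determined by its values on the facets. -/
lemma boundary_hom_ext {n : ℕ} {Y : SSet.{u}} {f g : (∂Δ[n + 1] : SSet.{u}) ⟶ Y}
    (h : ∀ d, f.app (op ⦋n⦌) (facet d) = g.app (op ⦋n⦌) (facet d)) : f = g := by
  refine SSet.boundary.hom_ext fun d => SSet.yonedaEquiv.injective ?_
  rw [SSet.yonedaEquiv_comp, SSet.yonedaEquiv_comp]
  exact h d

/-- A simplex on two facets `i < j` lies on their common face, where matching simplices agree. -/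
lemma map_eq_of_comp_δ_eq {n : ℕ} {Y : SSet.{u}} (y : Fin (n + 3) → Y _⦋n + 1⦌)
    (hy : ∀ i j : Fin (n + 2), i ≤ j → Y.δ j (y i.castSucc) = Y.δ i (y j.succ))
    {m : SimplexCategory} {d e : Fin (n + 3)} (θ η : m ⟶ ⦋n + 1⦌)
    (h : θ ≫ SimplexCategory.δ d = η ≫ SimplexCategory.δ e) :
    Y.map θ.op (y d) = Y.map η.op (y e) := by
  wlog hde : d ≤ e generalizing d e θ η
  · exact (this η θ h.symm (le_of_not_ge hde)).symm
  obtain rfl | hde := hde.eq_or_lt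
  · rw [cancel_mono] at h
    rw [h]
  obtain ⟨i, rfl⟩ : ∃ i : Fin (n + 2), d = i.castSucc :=
    ⟨d.castPred (Fin.ne_last_of_lt hde), by simp⟩
  obtain ⟨j, rfl⟩ : ∃ j : Fin (n + 2), e = j.succ := ⟨e.pred (Fin.ne_zero_of_lt hde), by simp⟩
  have hij : i ≤ j := by simpa [Fin.castSucc_lt_succ_iff] using hde
  obtain ⟨κ, rfl⟩ := SimplexCategory.eq_comp_δ_of_not_surjective' θ j fun x hx => by
    have h₁ : i.castSucc.succAbove (θ.toOrderHom x) = j.succ.succAbove (η.toOrderHom x) :=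
      congrArg (fun f => SimplexCategory.Hom.toOrderHom f x) h
    rw [hx, Fin.succAbove_of_le_castSucc _ _ (by simpa using hij)] at h₁
    exact Fin.succAbove_ne _ _ h₁.symm
  obtain rfl : η = κ ≫ SimplexCategory.δ i := by
    rw [← cancel_mono (SimplexCategory.δ j.succ), ← h, Category.assoc, Category.assoc,
      SimplexCategory.δ_comp_δ hij]
  have := congrArg (Y.map κ.op) (hy i j hij)
  rw [op_comp, op_comp, Functor.map_comp, Functor.map_comp]
  exact this

/-- A matching family of simplices on the facets extends to a map out of `∂Δ[n + 2]`. -/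
lemma exists_boundary_hom {n : ℕ} {Y : SSet.{u}} (y : Fin (n + 3) → Y _⦋n + 1⦌)
    (hy : ∀ i j : Fin (n + 2), i ≤ j → Y.δ j (y i.castSucc) = Y.δ i (y j.succ)) :
    ∃ f : (∂Δ[n + 2] : SSet.{u}) ⟶ Y, ∀ d, f.app (op ⦋n + 1⦌) (facet d) = y d := by
  choose d θ hθ using fun {m : SimplexCategoryᵒᵖ} (x : (∂Δ[n + 2] : SSet.{u}).obj m) =>
    exists_eq_map_facet x
  have key : ∀ {m : SimplexCategoryᵒᵖ} (x : (∂Δ[n + 2] : SSet.{u}).obj m) (e : Fin (n + 3))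
      (η : m.unop ⟶ ⦋n + 1⦌), x = (∂Δ[n + 2] : SSet.{u}).map η.op (facet e) →
      Y.map (θ x).op (y (d x)) = Y.map η.op (y e) := by
    intro m x e η hx
    refine map_eq_of_comp_δ_eq y hy _ _ (SSet.stdSimplex.objEquiv.{u}.symm.injective ?_)
    exact congrArg Subtype.val ((hθ x).symm.trans hx)
  refine ⟨{ app := fun m => ↾fun x => Y.map (θ x).op (y (d x)), naturality := ?_ }, fun e => ?_⟩
  · intro m m' f
    refine ConcreteCategory.hom_ext _ _ fun x => ?_
    refine (key _ (d x) (f.unop ≫ θ x) ?_).trans ?_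
    · conv_lhs => rw [hθ x]
      rfl
    · rw [op_comp, Functor.map_comp]
      rfl
  · refine (key (facet e) e (𝟙 _) ?_).trans ?_
    · rfl
    · exact ConcreteCategory.congr_hom (Y.map_id _) _

/-! ### Distributions on `(ℤ/2)ⁿ` for `n = 1, 2` -/

/-- The character `a ↦ (-1)ᵃ` of `ℤ/2`. -/
def sgn (a : ZMod 2) : ℝ := if a = 0 then 1 else -1

@[simp] lemma sgn_zero : sgn 0 = 1 := if_pos rfl

@[simp] lemma sgn_one : sgn 1 = -1 := if_neg one_ne_zero

lemma forall_zmod_two {P : ZMod 2 → Prop} : (∀ a, P a) ↔ P 0 ∧ P 1 := Fin.forall_fin_two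

lemma sgn_add (a b : ZMod 2) : sgn (a + b) = sgn a * sgn b := by
  revert a b
  simp [forall_zmod_two, show (1 + 1 : ZMod 2) = 0 from rfl]

lemma sgn_mul_self (a : ZMod 2) : sgn a * sgn a = 1 := by
  revert a
  simp [forall_zmod_two]

lemma exists_sgn_eq {x : ℝ} (hx : x * x = 1) : ∃ a, sgn a = x := by
  obtain rfl | rfl := mul_self_eq_one_iff.1 hx
  · exact ⟨0, sgn_zero⟩
  · exact ⟨1, sgn_one⟩

/-- The distribution with prescribed weights on a finite type. -/
def distOfWeights {α : Type*} [Fintype α] (w : α → ℝ) (h₀ : ∀ a, 0 ≤ w a) (h₁ : ∑ a, w a = 1) :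
    StdSimplex ℝ α where
  weights := Finsupp.equivFunOnFinite.symm w
  nonneg := h₀
  total := by
    rw [Finsupp.sum_fintype _ _ fun _ => rfl]
    exact h₁

lemma sum_weights {α : Type*} [Fintype α] (W : StdSimplex ℝ α) : ∑ a, W.weights a = 1 := by
  rw [← W.total, Finsupp.sum_fintype _ _ fun _ => rfl]

lemma weights_map_apply {α γ : Type*} [Fintype α] [DecidableEq γ] (f : α → γ)
    (W : StdSimplex ℝ α) (c : γ) :
    (W.map f).weights c = ∑ a, if f a = c then W.weights a else 0 := by
  rw [StdSimplex.weights_map, Finsupp.mapDomain, Finsupp.sum_fintype _ _ fun _ => by simp,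
    Finsupp.finsetSum_apply]
  simp [Finsupp.single_apply]

lemma sum_fin_one_zmod (f : (Fin 1 → ZMod 2) → ℝ) : ∑ a, f a = f ![0] + f ![1] := by
  rw [← (Equiv.funUnique (Fin 1) (ZMod 2)).symm.sum_comp]
  refine (Fin.sum_univ_two _).trans (congrArg₂ (· + ·) ?_ ?_) <;> congr 1 <;> ext k <;>
    fin_cases k <;> rfl

lemma sum_fin_two_zmod (f : (Fin 2 → ZMod 2) → ℝ) :
    ∑ a, f a = f ![0, 0] + f ![0, 1] + f ![1, 0] + f ![1, 1] := by
  rw [← (finTwoArrowEquiv (ZMod 2)).symm.sum_comp, Fintype.sum_prod_type]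
  refine (Fin.sum_univ_two _).trans ?_
  rw [add_assoc]
  exact congrArg₂ (· + ·) (Fin.sum_univ_two _) (Fin.sum_univ_two _)

/-- The expectation of the character `sgn` under a distribution on `ℤ/2`. -/
def expect (W : StdSimplex ℝ (Fin 1 → ZMod 2)) : ℝ := W.weights ![0] - W.weights ![1]

/-- The face maps `(ℤ/2)² → ℤ/2` of the twisted product above a triangle at which the cocycle has
the value `b`. -/
def faceCoord (b : ZMod 2) : Fin 3 → (Fin 2 → ZMod 2) → (Fin 1 → ZMod 2) :=
  ![fun a => ![a 1 + b], fun a => ![a 0 + a 1], fun a => ![a 0]]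

/-- The linear form in the expectations `u` on the faces of a triangle that computes the probability
of `(a, c)`; see `four_mul_weights`. -/
def faceForm (b a c : ZMod 2) (u : Fin 3 → ℝ) : ℝ :=
  sgn a * u 2 + sgn c * sgn b * u 0 + sgn (a + c) * u 1

lemma two_mul_weights (W : StdSimplex ℝ (Fin 1 → ZMod 2)) (a : ZMod 2) :
    2 * W.weights ![a] = 1 + sgn a * expect W := by
  have h := sum_weights W
  rw [sum_fin_one_zmod] at h
  rw [expect]
  revert a
  rw [forall_zmod_two, sgn_zero, sgn_one]
  constructor <;> linarith

/-- Fourier inversion on `(ℤ/2)²`: a distribution is determined by the expectations of the three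
non-trivial characters, which are the expectations of its faces. -/
lemma four_mul_weights (W : StdSimplex ℝ (Fin 2 → ZMod 2)) (b a c : ZMod 2) :
    4 * W.weights ![a, c] = 1 + faceForm b a c fun k => expect (W.map (faceCoord b k)) := by
  have h := sum_weights W
  rw [sum_fin_two_zmod] at h
  simp only [faceForm, expect, weights_map_apply, sum_fin_two_zmod, faceCoord]
  revert b a c
  simp [forall_zmod_two, show (1 + 1 : ZMod 2) = 0 from rfl]
  and_intros <;> linarith

lemma eq_fin_one (a : Fin 1 → ZMod 2) : a = ![a 0] := by
  ext k
  fin_cases k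
  rfl

lemma eq_fin_two (a : Fin 2 → ZMod 2) : a = ![a 0, a 1] := by
  ext k
  fin_cases k <;> rfl

lemma eq_of_expect_eq {W W' : StdSimplex ℝ (Fin 1 → ZMod 2)} (h : expect W = expect W') :
    W = W' := by
  ext a
  rw [eq_fin_one a]
  have h₁ := two_mul_weights W (a 0)
  have h₂ := two_mul_weights W' (a 0)
  rw [h] at h₁
  linarith

lemma eq_of_expect_face_eq (b : ZMod 2) {W W' : StdSimplex ℝ (Fin 2 → ZMod 2)}
    (h : ∀ k, expect (W.map (faceCoord b k)) = expect (W'.map (faceCoord b k))) : W = W' := by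
  ext a
  rw [eq_fin_two a]
  have h₁ := four_mul_weights W b (a 0) (a 1)
  have h₂ := four_mul_weights W' b (a 0) (a 1)
  simp only [h] at h₁
  linarith

/-- Expectations on the faces of a triangle come from a distribution on `(ℤ/2)²` as soon as the
resulting probabilities are non-negative. -/
lemma exists_expect_face_eq (b : ZMod 2) (u : Fin 3 → ℝ)
    (h : ∀ a c, 0 ≤ 1 + faceForm b a c u) :
    ∃ W : StdSimplex ℝ (Fin 2 → ZMod 2), ∀ k, expect (W.map (faceCoord b k)) = u k := by
  refine ⟨distOfWeights (fun a => (1 + faceForm b (a 0) (a 1) u) / 4)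
    (fun a => div_nonneg (h _ _) (by norm_num)) ?_, fun k => ?_⟩
  · rw [sum_fin_two_zmod]
    simp [faceForm, show (1 + 1 : ZMod 2) = 0 from rfl]
    ring
  · simp only [expect, weights_map_apply, sum_fin_two_zmod, distOfWeights, faceCoord]
    clear h
    revert b k
    simp [forall_zmod_two, Fin.forall_fin_succ, faceForm, show (1 + 1 : ZMod 2) = 0 from rfl]
    and_intros <;> ring

lemma expect_single (a : ZMod 2) : expect (.single ![a]) = sgn a := by
  have h := two_mul_weights (.single ![a]) a
  have h₁ := sgn_mul_self a
  simp only [StdSimplex.weights_single, Finsupp.single_eq_same] at h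
  have : sgn a * expect (.single ![a]) = sgn a * sgn a := by linarith
  exact mul_left_cancel₀ (fun h0 => by simp [h0] at h₁) this

/-- Non-negativity rules out cancellation in a pushforward. -/
lemma apply_eq_of_map_eq_single {α γ : Type*} {f : α → γ} {W : StdSimplex ℝ α} {c : γ}
    (h : W.map f = .single c) {a : α} (ha : W.weights a ≠ 0) : f a = c := by
  classical
  by_contra hne
  have h₁ : (W.map f).weights (f a) = 0 := by
    rw [h, StdSimplex.weights_single, Finsupp.single_eq_of_ne hne]
  rw [StdSimplex.weights_map, Finsupp.mapDomain, Finsupp.sum, Finsupp.finsetSum_apply,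
    Finset.sum_eq_zero_iff_of_nonneg fun i _ => by
      rw [Finsupp.single_apply]
      split_ifs
      exacts [W.weights_nonneg i, le_rfl]] at h₁
  exact ha (by simpa using h₁ a (Finsupp.mem_support_iff.2 ha))

lemma exists_eq_single_of_expect {W : StdSimplex ℝ (Fin 1 → ZMod 2)}
    (h : expect W * expect W = 1) : ∃ a, W = .single a := by
  obtain ⟨a, ha⟩ := exists_sgn_eq h
  exact ⟨![a], eq_of_expect_eq (by rw [expect_single, ha])⟩

/-- A distribution on `(ℤ/2)²` with two deterministic faces is deterministic. -/
lemma exists_eq_single_of_expect_face (b : ZMod 2) {W : StdSimplex ℝ (Fin 2 → ZMod 2)}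
    {k l : Fin 3} (hkl : k ≠ l)
    (hk : expect (W.map (faceCoord b k)) * expect (W.map (faceCoord b k)) = 1)
    (hl : expect (W.map (faceCoord b l)) * expect (W.map (faceCoord b l)) = 1) :
    ∃ a, W = .single a := by
  obtain ⟨s, hs⟩ := exists_eq_single_of_expect hk
  obtain ⟨t, ht⟩ := exists_eq_single_of_expect hl
  have inj : ∀ (b : ZMod 2) (k l : Fin 3), k ≠ l → ∀ a c, faceCoord b k a = faceCoord b k c →
      faceCoord b l a = faceCoord b l c → a = c := by
    decide
  obtain ⟨a, ha⟩ := W.support_weights_nonempty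
  refine ⟨a, StdSimplex.support_weights_eq_singleton.1
    (Finset.eq_singleton_iff_unique_mem.2 ⟨ha, fun c hc => ?_⟩)⟩
  rw [Finsupp.mem_support_iff] at ha hc
  exact inj b k l hkl c a
    ((apply_eq_of_map_eq_single hs hc).trans (apply_eq_of_map_eq_single hs ha).symm)
    ((apply_eq_of_map_eq_single ht hc).trans (apply_eq_of_map_eq_single ht ha).symm)

/-! ### Twisted distributions on edges and triangles -/

section

variable {X : SSet.{u}} {β : NormalizedCocycle X} {p q : X ⟶ distSSet (twistedProduct β)}

/-- The distribution `W` on `(ℤ/2)ⁿ`, placed on the fibre of the twisted product over the simplex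
`x`. -/
def fibreDist (β : NormalizedCocycle X) {n : ℕ} (x : X _⦋n⦌) (W : StdSimplex ℝ (Fin n → ZMod 2)) :
    (distSSet (twistedProduct β)) _⦋n⦌ :=
  W.map fun a => (show (twistedProduct β) _⦋n⦌ from (a, x))

lemma fibreDist_weights {n : ℕ} (x : X _⦋n⦌) (W : StdSimplex ℝ (Fin n → ZMod 2))
    (a : Fin n → ZMod 2) :
    StdSimplex.weights (show StdSimplex ℝ ((twistedProduct β).obj (op ⦋n⦌)) from
      fibreDist β x W) (show (twistedProduct β) _⦋n⦌ from (a, x)) = W.weights a :=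
  Finsupp.mapDomain_apply (fun _ _ h => congrArg Prod.fst h) _ _

lemma fibreDist_injective {n : ℕ} (x : X _⦋n⦌) : Function.Injective (fibreDist β x) := by
  intro W W' h
  ext a
  rw [← fibreDist_weights (β := β) x W, h, fibreDist_weights]

lemma fibreDist_single {n : ℕ} (x : X _⦋n⦌) (a : Fin n → ZMod 2) :
    fibreDist β x (.single a) = (delta (twistedProduct β)).app (op ⦋n⦌)
      (show (twistedProduct β) _⦋n⦌ from (a, x)) :=
  StdSimplex.map_single a _

lemma distMap_fibreDist {n : ℕ} (x : X _⦋n⦌) (W : StdSimplex ℝ (Fin n → ZMod 2)) :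
    (distMap (twistedProj β)).app (op ⦋n⦌) (fibreDist β x W) = (delta X).app (op ⦋n⦌) x :=
  (StdSimplex.map_map W _ _).trans (StdSimplex.map_const W x)

lemma δ_fibreDist (σ : X _⦋2⦌) (W : StdSimplex ℝ (Fin 2 → ZMod 2)) (k : Fin 3) :
    (distSSet (twistedProduct β)).δ k (fibreDist β σ W) =
      fibreDist β (X.δ k σ) (W.map (faceCoord (β σ) k)) := by
  refine (StdSimplex.map_map W _ _).trans (.trans ?_ (StdSimplex.map_map W _ _).symm)
  congr 1
  funext a
  obtain ⟨h₀, h₁, h₂⟩ := twistedProduct_face β (a 0) (a 1) σ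
  rw [← eq_fin_two a] at h₀ h₁ h₂
  fin_cases k
  exacts [h₀, h₁, h₂]

/-- The condition `D(π) ∘ p = δ` says that `p_x` lives on the fibre over `x`. -/
lemma exists_eq_fibreDist (hp : p ∈ twistedDist β) {n : ℕ} (x : X _⦋n⦌) :
    ∃ W, p.app (op ⦋n⦌) x = fibreDist β x W := by
  let P : StdSimplex ℝ ((Fin n → ZMod 2) × X _⦋n⦌) := p.app (op ⦋n⦌) x
  have hP : P.map Prod.snd = .single x :=
    ConcreteCategory.congr_hom (congr_app (show p ≫ _ = _ from hp) (op ⦋n⦌)) x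
  refine ⟨P.map Prod.fst, ?_⟩
  refine Eq.trans ?_ (StdSimplex.map_map P _ _).symm
  refine (StdSimplex.map_id P).symm.trans ?_
  ext : 1
  refine Finsupp.mapDomain_congr fun e he => ?_
  exact Prod.ext rfl (apply_eq_of_map_eq_single hP (Finsupp.mem_support_iff.1 he))

/-- The expectation of the character `sgn` under the distribution of `p` on an edge. -/
def edgeExpect (p : X ⟶ distSSet (twistedProduct β)) (x : X _⦋1⦌) : ℝ :=
  prob p x (show (twistedProduct β) _⦋1⦌ from (![0], x)) -
    prob p x (show (twistedProduct β) _⦋1⦌ from (![1], x))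

lemma prob_eq_weights {n : ℕ} {x : X _⦋n⦌} {W : StdSimplex ℝ (Fin n → ZMod 2)}
    (h : p.app (op ⦋n⦌) x = fibreDist β x W) (a : Fin n → ZMod 2) :
    prob p x (show (twistedProduct β) _⦋n⦌ from (a, x)) = W.weights a := by
  rw [prob, h]
  exact fibreDist_weights x W a

lemma edgeExpect_eq_expect {x : X _⦋1⦌} {W : StdSimplex ℝ (Fin 1 → ZMod 2)}
    (h : p.app (op ⦋1⦌) x = fibreDist β x W) : edgeExpect p x = expect W := by
  rw [edgeExpect, prob_eq_weights h, prob_eq_weights h, expect]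

lemma app_δ (p : X ⟶ distSSet (twistedProduct β)) {n : ℕ} (k : Fin (n + 2)) (σ : X _⦋n + 1⦌) :
    p.app (op ⦋n⦌) (X.δ k σ) = (distSSet (twistedProduct β)).δ k (p.app (op ⦋n + 1⦌) σ) :=
  ConcreteCategory.congr_hom (p.naturality (SimplexCategory.δ k).op) σ

lemma app_δ_eq_fibreDist {σ : X _⦋2⦌} {W : StdSimplex ℝ (Fin 2 → ZMod 2)}
    (h : p.app (op ⦋2⦌) σ = fibreDist β σ W) (k : Fin 3) :
    p.app (op ⦋1⦌) (X.δ k σ) = fibreDist β (X.δ k σ) (W.map (faceCoord (β σ) k)) := by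
  rw [app_δ, h, δ_fibreDist]

lemma edgeExpect_δ {σ : X _⦋2⦌} {W : StdSimplex ℝ (Fin 2 → ZMod 2)}
    (h : p.app (op ⦋2⦌) σ = fibreDist β σ W) (k : Fin 3) :
    edgeExpect p (X.δ k σ) = expect (W.map (faceCoord (β σ) k)) :=
  edgeExpect_eq_expect (app_δ_eq_fibreDist h k)

/-- The probabilities on a triangle in terms of the expectations on its edges. -/
lemma four_mul_prob (hp : p ∈ twistedDist β) (σ : X _⦋2⦌) (a c : ZMod 2) :
    4 * prob p σ (show (twistedProduct β) _⦋2⦌ from (![a, c], σ)) =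
      1 + faceForm (β σ) a c fun k => edgeExpect p (X.δ k σ) := by
  obtain ⟨W, hW⟩ := exists_eq_fibreDist hp σ
  rw [prob_eq_weights hW, four_mul_weights W (β σ)]
  simp only [edgeExpect_δ hW]

lemma prob_nonneg {Y : SSet.{u}} (p : X ⟶ distSSet Y) {n : SimplexCategoryᵒᵖ} (x : X.obj n)
    (e : Y.obj n) : 0 ≤ prob p x e :=
  StdSimplex.weights_nonneg _

lemma app_triangle_eq (hp : p ∈ twistedDist β) (hq : q ∈ twistedDist β) (σ : X _⦋2⦌)
    (h : ∀ k, edgeExpect p (X.δ k σ) = edgeExpect q (X.δ k σ)) :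
    p.app (op ⦋2⦌) σ = q.app (op ⦋2⦌) σ := by
  obtain ⟨W, hW⟩ := exists_eq_fibreDist hp σ
  obtain ⟨W', hW'⟩ := exists_eq_fibreDist hq σ
  have : W = W' := eq_of_expect_face_eq (β σ) fun k => by
    rw [← edgeExpect_δ hW, ← edgeExpect_δ hW', h]
  rw [hW, hW', this]

lemma eq_of_coords_eq {Y : SSet.{u}} {p q : X ⟶ distSSet Y} (h : coords p = coords q) : p = q := by
  ext n x
  refine StdSimplex.ext (Finsupp.ext fun e => ?_)
  exact congrFun (congrFun (congrFun h n) x) e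

/-! ### Deterministic simplices -/

lemma isDeterministicSimplex_edge_iff (hp : p ∈ twistedDist β) (x : X _⦋1⦌) :
    IsDeterministicSimplex p x ↔ x ∈ X.nonDegenerate 1 ∧ edgeExpect p x * edgeExpect p x = 1 := by
  obtain ⟨W, hW⟩ := exists_eq_fibreDist hp x
  rw [IsDeterministicSimplex, edgeExpect_eq_expect hW, hW]
  refine and_congr_right fun _ => ⟨fun ⟨a, ha⟩ => ?_, fun h => ?_⟩
  · rw [← fibreDist_single] at ha
    rw [fibreDist_injective x ha, eq_fin_one a, expect_single, sgn_mul_self]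
  · obtain ⟨a, rfl⟩ := exists_eq_single_of_expect h
    exact ⟨a, fibreDist_single x a⟩

lemma edgeExpect_δ_mul_self {σ : X _⦋2⦌} (hσ : IsDeterministicSimplex p σ) (k : Fin 3) :
    edgeExpect p (X.δ k σ) * edgeExpect p (X.δ k σ) = 1 := by
  obtain ⟨a, ha⟩ := hσ.2
  rw [← fibreDist_single] at ha
  rw [edgeExpect_δ ha, StdSimplex.map_single, eq_fin_one (faceCoord _ _ _), expect_single,
    sgn_mul_self]

lemma isDeterministicSimplex_triangle (hp : p ∈ twistedDist β) {σ : X _⦋2⦌}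
    (hσ : σ ∈ X.nonDegenerate 2) {k l : Fin 3} (hkl : k ≠ l)
    (hk : edgeExpect p (X.δ k σ) * edgeExpect p (X.δ k σ) = 1)
    (hl : edgeExpect p (X.δ l σ) * edgeExpect p (X.δ l σ) = 1) :
    IsDeterministicSimplex p σ := by
  obtain ⟨W, hW⟩ := exists_eq_fibreDist hp σ
  rw [edgeExpect_δ hW] at hk hl
  obtain ⟨a, rfl⟩ := exists_eq_single_of_expect_face _ hkl hk hl
  exact ⟨hσ, a, hW.trans (fibreDist_single σ a)⟩

/-- Faces of deterministic simplices are deterministic, so in dimensions `1` and `2` the subcomplex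
`Z_p` has no non-degenerate simplices besides the deterministic ones. -/
lemma mem_detSimplices_iff {n : ℕ} (hn : n = 1 ∨ n = 2) (x : X _⦋n⦌) :
    x ∈ detSimplices p n ↔ IsDeterministicSimplex p x := by
  have hface : ∀ {m : ℕ} (y : X _⦋m⦌), IsDeterministicSimplex p y → x ∈ X.nonDegenerate n →
      x ∈ (SSet.Subcomplex.ofSimplex y).obj (op ⦋n⦌) → IsDeterministicSimplex p x := by
    rintro m y ⟨-, a, ha⟩ hx hxy
    obtain ⟨f, rfl⟩ := (SSet.Subcomplex.mem_ofSimplex_obj_iff y x).1 hxy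
    refine ⟨hx, twistedCoord β f a y, ?_⟩
    have h₁ := ConcreteCategory.congr_hom (p.naturality f.op) y
    have h₂ := ConcreteCategory.congr_hom ((delta (twistedProduct β)).naturality f.op)
      (show (twistedProduct β) _⦋m⦌ from (a, y))
    refine h₁.trans (.trans ?_ h₂.symm)
    exact congrArg ((distSSet (twistedProduct β)).map f.op) ha
  constructor
  · rintro ⟨hx, hZ⟩
    simp only [detSubcomplex, Subfunctor.max_obj, Subfunctor.iSup_obj, Set.mem_union,
      Set.mem_iUnion] at hZ
    obtain ⟨⟨y, hy⟩, h⟩ | ⟨⟨y, hy⟩, h⟩ := hZ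
    · exact hface y hy hx h
    · exact hface y hy hx h
  · refine fun hx => ⟨hx.1, ?_⟩
    simp only [detSubcomplex, Subfunctor.max_obj, Subfunctor.iSup_obj, Set.mem_union,
      Set.mem_iUnion]
    obtain rfl | rfl := hn
    · exact .inl ⟨⟨x, hx⟩, SSet.Subcomplex.mem_ofSimplex_obj x⟩
    · exact .inr ⟨⟨x, hx⟩, SSet.Subcomplex.mem_ofSimplex_obj x⟩

end

/-! ### The polytope of edge expectations on the tetrahedron -/

/-- The edge of the facet opposite to `d` that is opposite to the `k`-th vertex of this facet. -/
def triEdge (d : Fin 4) (k : Fin 3) : Sym2 (Fin 4) :=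
  s(d.succAbove (k.succAbove 0), d.succAbove (k.succAbove 1))

/-- The linear form in the edge expectations `w` that computes the probability of `(a, c)` on the
facet opposite to `d`, for a cochain with value `b d` on that facet. -/
def triForm (b : Fin 4 → ZMod 2) (d : Fin 4) (a c : ZMod 2) (w : Sym2 (Fin 4) → ℝ) : ℝ :=
  faceForm (b d) a c fun k => w (triEdge d k)

/-- The polytope of edge expectations of the twisted distributions on the boundary of the
tetrahedron. -/
def Feasible (b : Fin 4 → ZMod 2) (w : Sym2 (Fin 4) → ℝ) : Prop :=
  ∀ d a c, 0 ≤ 1 + triForm b d a c w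

/-- The displacements `v` along which all inequalities that are equalities at `w` remain equalities.
The values of `v` at the diagonal are immaterial. -/
def PreservesTight (b : Fin 4 → ZMod 2) (w v : Sym2 (Fin 4) → ℝ) : Prop :=
  ∀ d a c, 1 + triForm b d a c w = 0 → triForm b d a c v = 0

/-- The point `w` of the polytope is a vertex: it has no non-zero displacement preserving the tight
inequalities. -/
def IsRigid (b : Fin 4 → ZMod 2) (w : Sym2 (Fin 4) → ℝ) : Prop :=
  ∀ v, PreservesTight b w v → ∀ z : Sym2 (Fin 4), ¬ z.IsDiag → v z = 0

/-- The four labels are distinct, so that they are the vertices of the tetrahedron. -/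
abbrev Labelling (i j k l : Fin 4) : Prop :=
  i ≠ j ∧ i ≠ k ∧ i ≠ l ∧ j ≠ k ∧ j ≠ l ∧ k ≠ l

lemma triForm_eq (b : Fin 4 → ZMod 2) (d : Fin 4) (a c : ZMod 2) (w : Sym2 (Fin 4) → ℝ) :
    triForm b d a c w = sgn a * w s(d.succAbove 0, d.succAbove 1) +
      sgn c * sgn (b d) * w s(d.succAbove 1, d.succAbove 2) +
      sgn a * sgn c * w s(d.succAbove 0, d.succAbove 2) := by
  rw [triForm, faceForm, sgn_add]
  rfl

lemma labelling_cases {i j k l : Fin 4} (h : Labelling i j k l) :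
    (i = l.succAbove 0 ∧ j = l.succAbove 1 ∧ k = l.succAbove 2) ∨
    (i = l.succAbove 0 ∧ j = l.succAbove 2 ∧ k = l.succAbove 1) ∨
    (i = l.succAbove 1 ∧ j = l.succAbove 0 ∧ k = l.succAbove 2) ∨
    (i = l.succAbove 1 ∧ j = l.succAbove 2 ∧ k = l.succAbove 0) ∨
    (i = l.succAbove 2 ∧ j = l.succAbove 0 ∧ k = l.succAbove 1) ∨
    (i = l.succAbove 2 ∧ j = l.succAbove 1 ∧ k = l.succAbove 0) := by
  revert i j k l
  decide

/-- The inequalities of a facet do not depend on an ordering of its vertices: they are indexed by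
the triples of signs on the edges whose product is the sign of the cochain. -/
lemma exists_triForm_eq (b : Fin 4 → ZMod 2) {i j k l : Fin 4} (h : Labelling i j k l)
    {x y : ℝ} (hx : x * x = 1) (hy : y * y = 1) :
    ∃ a c, ∀ w, triForm b l a c w =
      x * w s(i, j) + y * w s(j, k) + x * y * sgn (b l) * w s(i, k) := by
  obtain ⟨s, rfl⟩ := exists_sgn_eq hx
  obtain ⟨t, rfl⟩ := exists_sgn_eq hy
  have hs := sgn_mul_self s
  have ht := sgn_mul_self t
  have hb := sgn_mul_self (b l)
  simp only [triForm_eq]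
  obtain h | h | h | h | h | h := labelling_cases h
  all_goals
    obtain ⟨rfl, rfl, rfl⟩ := h
    try simp only [Sym2.eq_swap (a := l.succAbove 1) (b := l.succAbove 0),
      Sym2.eq_swap (a := l.succAbove 2) (b := l.succAbove 0),
      Sym2.eq_swap (a := l.succAbove 2) (b := l.succAbove 1)]
  · exact ⟨s, t + b l, fun w => by simp only [sgn_add]; grind⟩
  · exact ⟨s + t + b l, t + b l, fun w => by simp only [sgn_add]; grind⟩
  · exact ⟨s, s + t, fun w => by simp only [sgn_add]; grind⟩
  · exact ⟨s + t + b l, s + b l, fun w => by simp only [sgn_add]; grind⟩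
  · exact ⟨t, s + t, fun w => by simp only [sgn_add]; grind⟩
  · exact ⟨t, s + b l, fun w => by simp only [sgn_add]; grind⟩

lemma exists_signs_triForm_eq (b : Fin 4 → ZMod 2) {i j k l : Fin 4} (h : Labelling i j k l)
    (a c : ZMod 2) :
    ∃ x y : ℝ, x * x = 1 ∧ y * y = 1 ∧ ∀ w, triForm b l a c w =
      x * w s(i, j) + y * w s(j, k) + x * y * sgn (b l) * w s(i, k) := by
  have hs := sgn_mul_self a
  have ht := sgn_mul_self c
  have hb := sgn_mul_self (b l)
  simp only [triForm_eq]
  obtain h | h | h | h | h | h := labelling_cases h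
  all_goals
    obtain ⟨rfl, rfl, rfl⟩ := h
    try simp only [Sym2.eq_swap (a := l.succAbove 1) (b := l.succAbove 0),
      Sym2.eq_swap (a := l.succAbove 2) (b := l.succAbove 0),
      Sym2.eq_swap (a := l.succAbove 2) (b := l.succAbove 1)]
  · exact ⟨sgn a, sgn c * sgn (b l), by grind, by grind, by grind⟩
  · exact ⟨sgn a * sgn c, sgn c * sgn (b l), by grind, by grind, by grind⟩
  · exact ⟨sgn a, sgn a * sgn c, by grind, by grind, by grind⟩
  · exact ⟨sgn c * sgn (b l), sgn a * sgn c, by grind, by grind, by grind⟩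
  · exact ⟨sgn a * sgn c, sgn a, by grind, by grind, by grind⟩
  · exact ⟨sgn c * sgn (b l), sgn a, by grind, by grind, by grind⟩

section

variable {b : Fin 4 → ZMod 2} {w v : Sym2 (Fin 4) → ℝ} {i j k l : Fin 4}

lemma Feasible.nonneg (hw : Feasible b w) (h : Labelling i j k l) {x y : ℝ}
    (hx : x * x = 1) (hy : y * y = 1) :
    0 ≤ 1 + (x * w s(i, j) + y * w s(j, k) + x * y * sgn (b l) * w s(i, k)) := by
  obtain ⟨a, c, hac⟩ := exists_triForm_eq b h hx hy
  rw [← hac]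
  exact hw l a c

lemma PreservesTight.eq_zero (hv : PreservesTight b w v) (h : Labelling i j k l) {x y : ℝ}
    (hx : x * x = 1) (hy : y * y = 1)
    (hw : 1 + (x * w s(i, j) + y * w s(j, k) + x * y * sgn (b l) * w s(i, k)) = 0) :
    x * v s(i, j) + y * v s(j, k) + x * y * sgn (b l) * v s(i, k) = 0 := by
  obtain ⟨a, c, hac⟩ := exists_triForm_eq b h hx hy
  rw [← hac] at hw ⊢
  exact hv l a c hw

/-- On a triangle with a deterministic edge, the expectations on the two other edges agree up to a
sign. -/
lemma Feasible.eq_mul (hw : Feasible b w) (h : Labelling i j k l)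
    (hij : w s(i, j) * w s(i, j) = 1) :
    w s(i, k) = sgn (b l) * w s(i, j) * w s(j, k) := by
  have hx : -w s(i, j) * -w s(i, j) = 1 := by linarith
  have h₁ := hw.nonneg h hx (one_mul 1)
  have h₂ := hw.nonneg h hx (show (-1 : ℝ) * -1 = 1 by norm_num)
  have hb := sgn_mul_self (b l)
  have h₃ : w s(j, k) = sgn (b l) * w s(i, j) * w s(i, k) := by linarith
  grind

/-- The relation of `Feasible.eq_mul` also holds for displacements preserving the tight
inequalities, which moreover fix the deterministic edges. -/
lemma PreservesTight.of_deterministic (hw : Feasible b w) (hv : PreservesTight b w v)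
    (h : Labelling i j k l) (hij : w s(i, j) * w s(i, j) = 1) :
    v s(i, j) = 0 ∧ v s(i, k) = sgn (b l) * w s(i, j) * v s(j, k) := by
  have hx : -w s(i, j) * -w s(i, j) = 1 := by linarith
  have hb := sgn_mul_self (b l)
  have he := hw.eq_mul h hij
  have h₁ := hv.eq_zero h hx (one_mul 1) (by rw [he]; grind)
  have h₂ := hv.eq_zero h hx (show (-1 : ℝ) * -1 = 1 by norm_num) (by rw [he]; grind)
  have h₃ : w s(i, j) * v s(i, j) = 0 := by linarith
  have h₄ : v s(i, j) = 0 := by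
    rcases mul_eq_zero.1 h₃ with h₀ | h₀
    · simp [h₀] at hij
    · exact h₀
  have h₅ : v s(j, k) = sgn (b l) * w s(i, j) * v s(i, k) := by linarith
  exact ⟨h₄, by rw [h₅]; grind⟩

/-- On a facet with exactly one deterministic edge, the relations of
`PreservesTight.of_deterministic` suffice for a displacement to preserve the tight inequalities. -/
lemma triForm_eq_zero_of_deterministic (h : Labelling i j k l)
    (hij : w s(i, j) * w s(i, j) = 1) (hjk : w s(j, k) * w s(j, k) ≠ 1)
    (hw : Feasible b w) (hv : v s(i, j) = 0)
    (hv' : v s(i, k) = sgn (b l) * w s(i, j) * v s(j, k)) (a c : ZMod 2)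
    (ht : 1 + triForm b l a c w = 0) : triForm b l a c v = 0 := by
  obtain ⟨x, y, hx, hy, hac⟩ := exists_signs_triForm_eq b h a c
  have hb := sgn_mul_self (b l)
  have he := hw.eq_mul h hij
  rw [hac, he] at ht
  rw [hac, hv, hv']
  obtain hx' | hx' : x = w s(i, j) ∨ x = -w s(i, j) :=
    mul_self_eq_mul_self_iff.1 (hx.trans hij.symm)
  · refine absurd ?_ hjk
    have : w s(j, k) = -y := by
      have : y * (y * w s(j, k)) = -y * y := by grind
      grind
    rw [this]
    linarith
  · subst hx'
    grind

/-- The space of edge functions has dimension `6`, so it has a non-zero element killed by `5` given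
linear forms. -/
lemma exists_ne_zero_of_five (Φ : Fin 5 → (Sym2 (Fin 4) → ℝ) →ₗ[ℝ] ℝ) :
    ∃ v : Sym2 (Fin 4) → ℝ, (∃ z : Sym2 (Fin 4), ¬ z.IsDiag ∧ v z ≠ 0) ∧ ∀ m, Φ m v = 0 := by
  let L : (Sym2 (Fin 4) → ℝ) →ₗ[ℝ] (Fin 5 ⊕ Fin 4 → ℝ) :=
    LinearMap.pi (Sum.elim Φ fun i => LinearMap.proj s(i, i))
  -- The four diagonal coordinates are required to vanish as well, and `5 + 4 < 10`.
  have hlt : LinearMap.ker L ≠ ⊥ := LinearMap.ker_ne_bot_of_finrank_lt (by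
    norm_num [Sym2.card, Nat.choose])
  obtain ⟨v, hv, hv0⟩ := (Submodule.ne_bot_iff _).1 hlt
  have hL := fun m => congrFun (LinearMap.mem_ker.1 hv) m
  obtain ⟨z, hz⟩ := Function.ne_iff.1 hv0
  refine ⟨v, ⟨z, fun hd => hz ?_, hz⟩, fun m => hL (.inl m)⟩
  induction z with
  | _ i j =>
    obtain rfl := Sym2.mk_isDiag_iff.1 hd
    exact hL (.inr i)

/-- If at most one edge is deterministic, every facet contributes at most one tight inequality, up
to a multiple of the deterministic coordinate. -/
lemma not_isRigid_of_le_one (e : Sym2 (Fin 4))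
    (he : ∀ z : Sym2 (Fin 4), ¬ z.IsDiag → w z * w z = 1 → z = e) : ¬ IsRigid b w := by
  have hΨ : ∀ d, ∃ Ψ : (Sym2 (Fin 4) → ℝ) →ₗ[ℝ] ℝ, ∀ v, v e = 0 → Ψ v = 0 → ∀ a c,
      1 + triForm b d a c w = 0 → triForm b d a c v = 0 := by
    intro d
    by_cases hd : ∃ a c, 1 + triForm b d a c w = 0
    swap
    · exact ⟨0, fun v _ _ a c h => absurd ⟨a, c, h⟩ hd⟩
    obtain ⟨a, c, h⟩ := hd
    refine ⟨{ toFun := triForm b d a c, map_add' := ?_, map_smul' := ?_ }, ?_⟩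
    · intro x y
      simp only [triForm_eq, Pi.add_apply]
      ring
    · intro r x
      simp only [triForm_eq, Pi.smul_apply, smul_eq_mul, RingHom.id_apply]
      ring
    intro v hv hΨ a' c' h'
    change triForm b d a c v = 0 at hΨ
    have hne : ∀ k l : Fin 3, k ≠ l → ¬ (s(d.succAbove k, d.succAbove l) : Sym2 _).IsDiag :=
      fun k l hkl hd => hkl (Fin.succAbove_right_injective (Sym2.mk_isDiag_iff.1 hd))
    have key : ∀ k l : Fin 3, k ≠ l → w s(d.succAbove k, d.succAbove l) *
        w s(d.succAbove k, d.succAbove l) = 1 → v s(d.succAbove k, d.succAbove l) = 0 :=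
      fun k l hkl h1 => (he _ (hne k l hkl) h1) ▸ hv
    have h01 := key 0 1 (by decide)
    have h12 := key 1 2 (by decide)
    have h02 := key 0 2 (by decide)
    have hb := sgn_mul_self (b d)
    have ha := sgn_mul_self a
    have hc := sgn_mul_self c
    rw [triForm_eq] at h h' hΨ ⊢
    -- Two different tight sign patterns agree on exactly one edge, which is then deterministic.
    obtain h₁ | h₁ := mul_self_eq_mul_self_iff.1 ((sgn_mul_self a').trans ha.symm) <;>
    obtain h₂ | h₂ := mul_self_eq_mul_self_iff.1 ((sgn_mul_self c').trans hc.symm) <;>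
    rw [h₁, h₂] at h' ⊢
    · exact hΨ
    · have : w s(d.succAbove 0, d.succAbove 1) = -sgn a := by grind
      rw [h01 (by grind)] at hΨ ⊢
      linarith
    · have : w s(d.succAbove 1, d.succAbove 2) = -(sgn c * sgn (b d)) := by grind
      rw [h12 (by grind)] at hΨ ⊢
      linarith
    · have : w s(d.succAbove 0, d.succAbove 2) = -(sgn a * sgn c) := by grind
      rw [h02 (by grind)] at hΨ ⊢
      linarith
  choose Ψ hΨ using hΨ
  obtain ⟨v, ⟨z, hz, hvz⟩, hv⟩ := exists_ne_zero_of_five (Fin.cons (LinearMap.proj e) Ψ)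
  exact fun hr => hvz (hr v (fun d a c h => hΨ d v (hv 0) (hv d.succ) a c h) z hz)

lemma prod_sgn_eq (b : Fin 4 → ZMod 2) (h : Labelling i j k l) :
    sgn (b i) * sgn (b j) * sgn (b k) * sgn (b l) = sgn (∑ d, b d) := by
  have hu : (Finset.univ : Finset (Fin 4)) = {i, j, k, l} := by
    revert i j k l
    decide
  obtain ⟨h₁, h₂, h₃, h₄, h₅, h₆⟩ := h
  rw [hu, Finset.sum_insert (by simp [*]), Finset.sum_insert (by simp [*]),
    Finset.sum_insert (by simp [*]), Finset.sum_singleton, sgn_add, sgn_add, sgn_add]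
  ring

lemma labelling_vertex (h : Labelling i j k l) (d : Fin 4) : d = i ∨ d = j ∨ d = k ∨ d = l := by
  revert i j k l d
  decide

lemma forall_edge_iff (h : Labelling i j k l) :
    (∀ z : Sym2 (Fin 4), ¬ z.IsDiag → v z = 0) ↔ v s(i, j) = 0 ∧ v s(i, k) = 0 ∧ v s(i, l) = 0 ∧
      v s(j, k) = 0 ∧ v s(j, l) = 0 ∧ v s(k, l) = 0 := by
  constructor
  · obtain ⟨h₁, h₂, h₃, h₄, h₅, h₆⟩ := h
    refine fun hv => ⟨?_, ?_, ?_, ?_, ?_, ?_⟩ <;> exact hv _ (by simpa)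
  · rintro ⟨h₁, h₂, h₃, h₄, h₅, h₆⟩ z hz
    induction z with
    | _ a c =>
      obtain rfl | rfl | rfl | rfl := labelling_vertex h a <;>
      obtain rfl | rfl | rfl | rfl := labelling_vertex h c <;>
      first
        | exact absurd rfl hz
        | assumption
        | rwa [Sym2.eq_swap]

lemma sgn_eq_neg_one {a : ZMod 2} (ha : a ≠ 0) : sgn a = -1 := if_neg ha

/-- With two opposite deterministic edges, the four other edges form a cycle along which the
coordinates of a displacement agree up to signs. The product of these signs is `-1` exactly when the
cochain is not a coboundary, and only then does it force the displacement to vanish. -/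
lemma isRigid_iff_of_opposite (hw : Feasible b w) (h : Labelling i j k l)
    (hij : w s(i, j) * w s(i, j) = 1) (hkl : w s(k, l) * w s(k, l) = 1)
    (hjk : w s(j, k) * w s(j, k) ≠ 1) (hjl : w s(j, l) * w s(j, l) ≠ 1)
    (hil : w s(i, l) * w s(i, l) ≠ 1) : IsRigid b w ↔ ∑ d, b d ≠ 0 := by
  have hb := prod_sgn_eq b h
  have hi := sgn_mul_self (b i)
  have hj := sgn_mul_self (b j)
  have hk := sgn_mul_self (b k)
  have hl := sgn_mul_self (b l)
  have L₁ : Labelling k l j i := by tauto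
  have L₂ : Labelling i j l k := by tauto
  have L₃ : Labelling k l i j := by tauto
  constructor
  · intro hr h0
    rw [h0, sgn_zero] at hb
    obtain ⟨v, ⟨z, hz, hvz⟩, hv⟩ := exists_ne_zero_of_five
      ![LinearMap.proj s(i, j), LinearMap.proj s(k, l),
        LinearMap.proj s(i, k) - (sgn (b l) * w s(i, j)) • LinearMap.proj s(j, k),
        LinearMap.proj s(j, k) - (sgn (b i) * w s(k, l)) • LinearMap.proj s(j, l),
        LinearMap.proj s(i, l) - (sgn (b k) * w s(i, j)) • LinearMap.proj s(j, l)]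
    simp only [Fin.forall_fin_succ, Matrix.cons_val_zero, Matrix.cons_val_succ,
      LinearMap.proj_apply, LinearMap.sub_apply, LinearMap.smul_apply, smul_eq_mul, sub_eq_zero] at hv
    obtain ⟨v₁, v₂, v₃, v₄, v₅, -⟩ := hv
    have v₆ : v s(k, i) = sgn (b j) * w s(k, l) * v s(l, i) := by
      rw [Sym2.eq_swap, v₃, v₄, Sym2.eq_swap (a := l), v₅]
      grind
    refine hvz (hr v (fun d a c ht => ?_) z hz)
    obtain rfl | rfl | rfl | rfl := labelling_vertex h d
    · exact triForm_eq_zero_of_deterministic L₁ hkl (by rwa [Sym2.eq_swap]) hw v₂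
        (by rw [Sym2.eq_swap, v₄, Sym2.eq_swap (a := j)]) a c ht
    · exact triForm_eq_zero_of_deterministic L₃ hkl (by rwa [Sym2.eq_swap]) hw v₂ v₆ a c ht
    · exact triForm_eq_zero_of_deterministic L₂ hij hjl hw v₁ v₅ a c ht
    · exact triForm_eq_zero_of_deterministic h hij hjk hw v₁ v₃ a c ht
  · intro h0 v hv
    rw [sgn_eq_neg_one h0] at hb
    obtain ⟨v₁, v₃⟩ := hv.of_deterministic hw h hij
    obtain ⟨v₂, v₄⟩ := hv.of_deterministic hw L₁ hkl
    obtain ⟨-, v₅⟩ := hv.of_deterministic hw L₂ hij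
    obtain ⟨-, v₆⟩ := hv.of_deterministic hw L₃ hkl
    rw [Sym2.eq_swap, Sym2.eq_swap (a := l)] at v₄ v₆
    have v₀ : v s(j, l) = 0 := by grind
    rw [v₀, mul_zero] at v₄ v₅
    rw [v₄, mul_zero] at v₃
    exact (forall_edge_iff h).2 ⟨v₁, v₃, v₅, v₄, v₀, v₂⟩

/-- With a deterministic facet, the coordinates of a displacement on the three edges at the opposite
vertex agree up to signs, and the product of the signs around that vertex is again `-1` exactly when
the cochain is not a coboundary. -/
lemma isRigid_iff_of_facet (hw : Feasible b w) (h : Labelling i j k l)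
    (hij : w s(i, j) * w s(i, j) = 1) (hjk : w s(j, k) * w s(j, k) = 1)
    (hik : w s(i, k) * w s(i, k) = 1) (hjl : w s(j, l) * w s(j, l) ≠ 1)
    (hkl : w s(k, l) * w s(k, l) ≠ 1) : IsRigid b w ↔ ∑ d, b d ≠ 0 := by
  have hb := prod_sgn_eq b h
  have hi := sgn_mul_self (b i)
  have hj := sgn_mul_self (b j)
  have hk := sgn_mul_self (b k)
  have hl := sgn_mul_self (b l)
  have he := hw.eq_mul h hij
  have L₁ : Labelling i j l k := by tauto
  have L₂ : Labelling j k l i := by tauto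
  have L₃ : Labelling i k l j := by tauto
  constructor
  · intro hr h0
    rw [h0, sgn_zero] at hb
    obtain ⟨v, ⟨z, hz, hvz⟩, hv⟩ := exists_ne_zero_of_five
      ![LinearMap.proj s(i, j), LinearMap.proj s(j, k), LinearMap.proj s(i, k),
        LinearMap.proj s(i, l) - (sgn (b k) * w s(i, j)) • LinearMap.proj s(j, l),
        LinearMap.proj s(j, l) - (sgn (b i) * w s(j, k)) • LinearMap.proj s(k, l)]
    simp only [Fin.forall_fin_succ, Matrix.cons_val_zero, Matrix.cons_val_succ,
      LinearMap.proj_apply, LinearMap.sub_apply, LinearMap.smul_apply, smul_eq_mul, sub_eq_zero] at hv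
    obtain ⟨v₁, v₂, v₃, v₄, v₅, -⟩ := hv
    have v₆ : v s(i, l) = sgn (b j) * w s(i, k) * v s(k, l) := by
      rw [v₄, v₅, he]
      grind
    refine hvz (hr v (fun d a c ht => ?_) z hz)
    obtain rfl | rfl | rfl | rfl := labelling_vertex h d
    · exact triForm_eq_zero_of_deterministic L₂ hjk hkl hw v₂ v₅ a c ht
    · exact triForm_eq_zero_of_deterministic L₃ hik hkl hw v₃ v₆ a c ht
    · exact triForm_eq_zero_of_deterministic L₁ hij hjl hw v₁ v₄ a c ht
    · obtain ⟨x, y, -, -, hxy⟩ := exists_signs_triForm_eq b h a c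
      rw [hxy, v₁, v₂, v₃]
      ring
  · intro h0 v hv
    rw [sgn_eq_neg_one h0] at hb
    obtain ⟨v₁, v₄⟩ := hv.of_deterministic hw L₁ hij
    obtain ⟨v₂, v₅⟩ := hv.of_deterministic hw L₂ hjk
    obtain ⟨v₃, v₆⟩ := hv.of_deterministic hw L₃ hik
    have v₀ : v s(k, l) = 0 := by grind
    rw [v₀, mul_zero] at v₅
    rw [v₅, mul_zero] at v₄
    exact (forall_edge_iff h).2 ⟨v₁, v₃, v₄, v₂, v₅, v₀⟩

end

/-! ### Edges and triangles of the boundary of the tetrahedron -/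

lemma boundary_simplex_ext {n m : ℕ} {x y : (∂Δ[n] : SSet.{0}) _⦋m⦌} (h : ∀ i, x.1 i = y.1 i) :
    x = y :=
  Subtype.ext (SSet.stdSimplex.ext _ _ h)

/-- The edge of the tetrahedron with the given endpoints. -/
def tetEdge (z : Sym2 (Fin 4)) : (∂Δ[3] : SSet.{0}) _⦋1⦌ :=
  ⟨SSet.stdSimplex.edge 3 z.inf z.sup z.inf_le_sup, by
    rw [SSet.boundary_obj_eq_univ 1 3]
    trivial⟩

lemma δ_facet (d : Fin 4) (k : Fin 3) :
    (∂Δ[3] : SSet.{0}).δ k (facet d) = tetEdge (triEdge d k) := by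
  refine boundary_simplex_ext fun i => ?_
  have hle : d.succAbove (k.succAbove 0) ≤ d.succAbove (k.succAbove 1) :=
    (Fin.strictMono_succAbove d).monotone ((Fin.strictMono_succAbove k).monotone (by decide))
  fin_cases i
  · exact (inf_of_le_left hle).symm
  · exact (sup_of_le_right hle).symm

lemma mem_nonDegenerate_boundary_iff {n m : ℕ} (x : (∂Δ[n] : SSet.{0}) _⦋m⦌) :
    x ∈ (∂Δ[n] : SSet.{0}).nonDegenerate m ↔ StrictMono x.1 :=
  (SSet.Subcomplex.mem_nonDegenerate_iff _ x).trans
    (SSet.stdSimplex.mem_nonDegenerate_iff_strictMono x.1)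

lemma mem_nonDegenerate_one_iff (x : (∂Δ[3] : SSet.{0}) _⦋1⦌) :
    x ∈ (∂Δ[3] : SSet.{0}).nonDegenerate 1 ↔ ∃ z : Sym2 (Fin 4), ¬ z.IsDiag ∧ tetEdge z = x := by
  rw [mem_nonDegenerate_boundary_iff]
  constructor
  · intro hx
    have h01 : x.1 0 < x.1 1 := hx (by decide)
    refine ⟨s(x.1 0, x.1 1), by simpa using h01.ne, boundary_simplex_ext fun i => ?_⟩
    fin_cases i
    · exact inf_of_le_left h01.le
    · exact sup_of_le_right h01.le
  · rintro ⟨z, hz, rfl⟩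
    rw [Fin.strictMono_iff_lt_succ]
    intro i
    fin_cases i
    change z.inf < z.sup
    revert z
    decide

lemma mem_nonDegenerate_two_iff (x : (∂Δ[3] : SSet.{0}) _⦋2⦌) :
    x ∈ (∂Δ[3] : SSet.{0}).nonDegenerate 2 ↔ ∃ d, facet d = x := by
  rw [mem_nonDegenerate_boundary_iff]
  constructor
  · intro hx
    have h01 : x.1 0 < x.1 1 := hx (by decide)
    have h12 : x.1 1 < x.1 2 := hx (by decide)
    have key : ∀ a b c : Fin 4, a < b → b < c →
        ∃ d : Fin 4, d.succAbove 0 = a ∧ d.succAbove 1 = b ∧ d.succAbove 2 = c := by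
      decide
    obtain ⟨d, h₀, h₁, h₂⟩ := key _ _ _ h01 h12
    refine ⟨d, boundary_simplex_ext fun i => ?_⟩
    fin_cases i
    exacts [h₀, h₁, h₂]
  · rintro ⟨d, rfl⟩
    exact Fin.strictMono_succAbove d

lemma facet_injective : Function.Injective (facet.{0} (n := 2)) := by
  intro d e h
  have key : ∀ d e : Fin 4, d.succAbove 0 = e.succAbove 0 → d.succAbove 1 = e.succAbove 1 →
      d.succAbove 2 = e.succAbove (2 : Fin 3) → d = e := by
    decide
  have h' := fun i : Fin 3 => congrArg (fun x : (∂Δ[3] : SSet.{0}) _⦋2⦌ => x.1 i) h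
  exact key d e (h' 0) (h' 1) (h' 2)

lemma tetEdge_injective : Function.Injective tetEdge := by
  intro z z' h
  have key : ∀ z z' : Sym2 (Fin 4), z.inf = z'.inf → z.sup = z'.sup → z = z' := by
    decide
  have h' := fun i : Fin 2 => congrArg (fun x : (∂Δ[3] : SSet.{0}) _⦋1⦌ => x.1 i) h
  exact key z z' (h' 0) (h' 1)

/-! ### Twisted distributions on the tetrahedron as points of the polytope -/

section

variable {β : NormalizedCocycle (∂Δ[3] : SSet.{0})}
  {p q : (∂Δ[3] : SSet.{0}) ⟶ distSSet (twistedProduct β)}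

/-- The values of the cocycle on the four triangles. -/
def facetValue (β : NormalizedCocycle (∂Δ[3] : SSet.{0})) (d : Fin 4) : ZMod 2 := β (facet d)

/-- The edge expectations of a twisted distribution on the tetrahedron. -/
def expectations (p : (∂Δ[3] : SSet.{0}) ⟶ distSSet (twistedProduct β)) (z : Sym2 (Fin 4)) : ℝ :=
  edgeExpect p (tetEdge z)

lemma four_mul_prob_facet (hp : p ∈ twistedDist β) (d : Fin 4) (a c : ZMod 2) :
    4 * prob p (facet d) (show (twistedProduct β) _⦋2⦌ from (![a, c], facet d)) =
      1 + triForm (facetValue β) d a c (expectations p) := by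
  rw [four_mul_prob hp]
  simp only [δ_facet]
  rfl

lemma feasible_expectations (hp : p ∈ twistedDist β) :
    Feasible (facetValue β) (expectations p) := by
  intro d a c
  rw [← four_mul_prob_facet hp]
  exact mul_nonneg (by norm_num) (prob_nonneg _ _ _)

lemma not_isDiag_triEdge (d : Fin 4) (k : Fin 3) : ¬ (triEdge d k).IsDiag := by
  revert d k
  decide

/-- A twisted distribution is determined by its edge expectations. -/
lemma eq_of_expectations_eq (hp : p ∈ twistedDist β) (hq : q ∈ twistedDist β)
    (h : ∀ z : Sym2 (Fin 4), ¬ z.IsDiag → expectations p z = expectations q z) : p = q := by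
  refine boundary_hom_ext fun d => app_triangle_eq hp hq (facet d) fun k => ?_
  rw [δ_facet]
  exact h _ (not_isDiag_triEdge d k)

/-- Every point of the polytope is realized by a twisted distribution. -/
lemma exists_expectations_eq {w : Sym2 (Fin 4) → ℝ} (hw : Feasible (facetValue β) w) :
    ∃ p ∈ twistedDist β, ∀ z : Sym2 (Fin 4), ¬ z.IsDiag → expectations p z = w z := by
  choose W hW using fun d => exists_expect_face_eq (facetValue β d) (fun k => w (triEdge d k))
    (hw d)
  have hδ : ∀ (d : Fin 4) (k : Fin 3),
      (distSSet (twistedProduct β)).δ k (fibreDist β (facet d) (W d)) =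
        fibreDist β (tetEdge (triEdge d k)) ((W d).map (faceCoord (facetValue β d) k)) := by
    intro d k
    rw [δ_fibreDist, δ_facet]
    rfl
  obtain ⟨p, hp⟩ := exists_boundary_hom (n := 1) (fun d => fibreDist β (facet d) (W d))
    fun i j hij => by
      have hE : ∀ i j : Fin 3, i ≤ j → triEdge i.castSucc j = triEdge j.succ i := by decide
      have h := (hW i.castSucc j).trans ((congrArg w (hE i j hij)).trans (hW j.succ i).symm)
      rw [hδ, hδ, hE i j hij, eq_of_expect_eq h]
  have hmem : p ∈ twistedDist β := boundary_hom_ext fun d => by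
    refine .trans ?_ (distMap_fibreDist (β := β) (facet d) (W d))
    exact congrArg ((distMap (twistedProj β)).app (op ⦋2⦌)) (hp d)
  refine ⟨p, hmem, fun z hz => ?_⟩
  obtain ⟨d, k, rfl⟩ : ∃ d k, triEdge d k = z := by
    revert z
    decide
  rw [expectations, ← δ_facet, edgeExpect_δ (hp d)]
  exact hW d k

lemma triForm_add_smul (b : Fin 4 → ZMod 2) (d : Fin 4) (a c : ZMod 2)
    (w v : Sym2 (Fin 4) → ℝ) (t : ℝ) :
    triForm b d a c (w + t • v) = triForm b d a c w + t * triForm b d a c v := by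
  simp only [triForm_eq, Pi.add_apply, Pi.smul_apply, smul_eq_mul]
  ring

/-- A displacement preserving the tight inequalities stays in the polytope for a short time. -/
lemma eventually_feasible {b : Fin 4 → ZMod 2} {w v : Sym2 (Fin 4) → ℝ} (hw : Feasible b w)
    (hv : PreservesTight b w v) : ∀ᶠ t : ℝ in nhds 0, Feasible b (w + t • v) := by
  simp only [Feasible, Filter.eventually_all, triForm_add_smul]
  intro d a c
  obtain h | h := (hw d a c).eq_or_lt
  · rw [hv d a c h.symm]
    exact .of_forall fun t => by rw [mul_zero, add_zero, ← h]
  · have hc : Filter.Tendsto (fun t : ℝ => 1 + (triForm b d a c w + t * triForm b d a c v)) (nhds 0)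
        (nhds (1 + (triForm b d a c w + 0 * triForm b d a c v))) :=
      (by fun_prop : Continuous fun t : ℝ =>
        1 + (triForm b d a c w + t * triForm b d a c v)).tendsto 0
    rw [zero_mul, add_zero] at hc
    exact (hc.eventually (lt_mem_nhds h)).mono fun t ht => ht.le

lemma expectations_eq_of_coords {r : (∂Δ[3] : SSet.{0}) ⟶ distSSet (twistedProduct β)} {s t : ℝ}
    (h : s • coords q + t • coords r = coords p) (z : Sym2 (Fin 4)) :
    s * expectations q z + t * expectations r z = expectations p z := by
  have key : ∀ e, s * prob q (tetEdge z) e + t * prob r (tetEdge z) e = prob p (tetEdge z) e :=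
    fun e => congrFun (congrFun (congrFun h (op ⦋1⦌)) (tetEdge z)) e
  rw [expectations, expectations, expectations, edgeExpect, edgeExpect, edgeExpect, ← key, ← key]
  ring

lemma exists_facet_weights (hp : p ∈ twistedDist β) (d : Fin 4) :
    ∃ W : StdSimplex ℝ (Fin 2 → ZMod 2), p.app (op ⦋2⦌) (facet d) = fibreDist β (facet d) W ∧
      ∀ a c, 4 * W.weights ![a, c] = 1 + triForm (facetValue β) d a c (expectations p) := by
  obtain ⟨W, hW⟩ := exists_eq_fibreDist hp (facet d)
  refine ⟨W, hW, fun a c => ?_⟩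
  rw [← four_mul_prob_facet hp, prob_eq_weights hW]

lemma triForm_congr {b : Fin 4 → ZMod 2} {w v : Sym2 (Fin 4) → ℝ}
    (h : ∀ z : Sym2 (Fin 4), ¬ z.IsDiag → w z = v z) (d : Fin 4) (a c : ZMod 2) :
    triForm b d a c w = triForm b d a c v := by
  simp only [triForm, h _ (not_isDiag_triEdge d _)]

/-- The correspondence between twisted distributions and points of the polytope is affine. -/
lemma coords_eq_of_expectations {r : (∂Δ[3] : SSet.{0}) ⟶ distSSet (twistedProduct β)}
    (hp : p ∈ twistedDist β) (hq : q ∈ twistedDist β) (hr : r ∈ twistedDist β) {s t : ℝ}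
    (hst : s + t = 1) (h : ∀ z : Sym2 (Fin 4), ¬ z.IsDiag →
      s * expectations q z + t * expectations r z = expectations p z) :
    s • coords q + t • coords r = coords p := by
  funext n x e
  obtain ⟨d, θ, rfl⟩ := exists_eq_map_facet x
  obtain ⟨P, hP, hP'⟩ := exists_facet_weights hp d
  obtain ⟨Q, hQ, hQ'⟩ := exists_facet_weights hq d
  obtain ⟨R, hR, hR'⟩ := exists_facet_weights hr d
  have hW : s • Q.weights + t • R.weights = P.weights := by
    ext a
    rw [eq_fin_two a, Finsupp.add_apply, Finsupp.smul_apply, Finsupp.smul_apply, smul_eq_mul,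
      smul_eq_mul]
    have h₁ := hP' (a 0) (a 1)
    have h₂ := hQ' (a 0) (a 1)
    have h₃ := hR' (a 0) (a 1)
    rw [← triForm_congr h, triForm_eq] at h₁
    rw [triForm_eq] at h₂ h₃
    linear_combination (s * h₂ + t * h₃ - h₁) / 4 + hst / 4
  have key : ∀ {u : (∂Δ[3] : SSet.{0}) ⟶ distSSet (twistedProduct β)}
      {U : StdSimplex ℝ (Fin 2 → ZMod 2)}, u.app (op ⦋2⦌) (facet d) = fibreDist β (facet d) U →
      coords u n ((∂Δ[3] : SSet.{0}).map θ.op (facet d)) e =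
        (U.weights.mapDomain fun a => (twistedProduct β).map θ.op
          (show (twistedProduct β) _⦋2⦌ from (a, facet d))) e := by
    intro u U hU
    have h₁ := ConcreteCategory.congr_hom (u.naturality θ.op) (facet d)
    have h₂ : u.app n ((∂Δ[3] : SSet.{0}).map θ.op (facet d)) =
        (distSSet (twistedProduct β)).map θ.op (fibreDist β (facet d) U) :=
      h₁.trans (congrArg ((distSSet (twistedProduct β)).map θ.op) hU)
    have h₃ : (distSSet (twistedProduct β)).map θ.op (fibreDist β (facet d) U) =
        U.map fun a => (twistedProduct β).map θ.op
          (show (twistedProduct β) _⦋2⦌ from (a, facet d)) :=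
      StdSimplex.map_map U _ _
    rw [coords, prob, h₂, h₃]
    rfl
  refine Eq.trans (congrArg₂ (fun A B => s * A + t * B) (key hQ) (key hR)) ?_
  rw [key hP, ← hW, Finsupp.mapDomain_add, Finsupp.mapDomain_smul, Finsupp.mapDomain_smul]
  rfl

/-- Vertices are the points at which the tight inequalities have full rank. -/
lemma isVertex_iff_isRigid (hp : p ∈ twistedDist β) :
    IsVertex β p ↔ IsRigid (facetValue β) (expectations p) := by
  constructor
  · rintro ⟨-, -, hext⟩ v hv z hz
    have h := eventually_feasible (feasible_expectations hp) hv
    have h' := (neg_zero (G := ℝ) ▸ (continuous_neg (G := ℝ)).tendsto 0).eventually h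
    obtain ⟨t, ⟨h₁, h₂⟩, ht⟩ := (((h.and h').filter_mono nhdsWithin_le_nhds).and
      (self_mem_nhdsWithin (s := Set.Ioi 0))).exists
    obtain ⟨q, hq, hq'⟩ := exists_expectations_eq h₁
    obtain ⟨r, hr, hr'⟩ := exists_expectations_eq h₂
    have hmid : (1 / 2 : ℝ) • coords q + (1 / 2 : ℝ) • coords r = coords p :=
      coords_eq_of_expectations hp hq hr (by norm_num) fun z hz => by
        rw [hq' z hz, hr' z hz]
        simp only [Pi.add_apply, Pi.smul_apply, smul_eq_mul]
        ring
    have hqp := hext ⟨q, hq, rfl⟩ ⟨r, hr, rfl⟩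
      ⟨1 / 2, 1 / 2, by norm_num, by norm_num, by norm_num, hmid⟩
    have := hq' z hz
    rw [eq_of_coords_eq hqp, Pi.add_apply, Pi.smul_apply, smul_eq_mul, left_eq_add] at this
    exact (mul_eq_zero.1 this).resolve_left (ne_of_gt ht)
  · refine fun hrig => ⟨hp, ⟨p, hp, rfl⟩, ?_⟩
    rintro _ ⟨q, hq, rfl⟩ _ ⟨r, hr, rfl⟩ ⟨s, t, hs, ht, hst, h⟩
    have hexp := expectations_eq_of_coords h
    have hv := hrig (expectations q + (-1 : ℝ) • expectations p) fun d a c h0 => by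
      have h₁ := feasible_expectations hq d a c
      have h₂ := feasible_expectations hr d a c
      have h₃ : s * (1 + triForm (facetValue β) d a c (expectations q)) +
          t * (1 + triForm (facetValue β) d a c (expectations r)) = 0 := by
        rw [← h0]
        simp only [triForm_eq, ← hexp]
        linear_combination hst
      have h₄ := mul_nonneg hs.le h₁
      have h₅ := mul_nonneg ht.le h₂
      have h₆ := (mul_eq_zero.1 (le_antisymm (by linarith) h₄)).resolve_left hs.ne'
      rw [triForm_add_smul]
      linarith
    rw [eq_of_expectations_eq hq hp fun z hz => by
      have := hv z hz
      simp only [Pi.add_apply, Pi.smul_apply, smul_eq_mul] at this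
      linarith]

/-! ### The cohomology class of the cocycle -/

/-- The cone with apex `0` over an edge of the tetrahedron. Three vertices do not exhaust the
tetrahedron, so it lies in the boundary. -/
def cone (x : (∂Δ[3] : SSet.{0}) _⦋1⦌) : (∂Δ[3] : SSet.{0}) _⦋2⦌ :=
  ⟨SSet.stdSimplex.triangle 0 (x.1 0) (x.1 1) (Fin.zero_le _)
    (SSet.stdSimplex.monotone_apply x.1 (by decide)), by
    rw [SSet.boundary_obj_eq_univ 2 3]
    trivial⟩

lemma coboundary_apply (X : SSet.{u}) (n : ℕ) (α : X _⦋n⦌ → ZMod 2) (x : X _⦋n + 1⦌) :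
    coboundary X n α x = ∑ i : Fin (n + 2), α (X.δ i x) := by
  simp [coboundary, show (-1 : ZMod 2) = 1 from rfl]

lemma sum_sum_triEdge (γ : Sym2 (Fin 4) → ZMod 2) : ∑ d, ∑ k, γ (triEdge d k) = 0 := by
  have e : triEdge 1 0 = triEdge 0 0 ∧ triEdge 2 0 = triEdge 0 1 ∧ triEdge 3 0 = triEdge 0 2 ∧
      triEdge 2 1 = triEdge 1 1 ∧ triEdge 3 1 = triEdge 1 2 ∧ triEdge 3 2 = triEdge 2 2 := by
    decide
  obtain ⟨h₁, h₂, h₃, h₄, h₅, h₆⟩ := e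
  simp only [Fin.sum_univ_four, Fin.sum_univ_three, h₁, h₂, h₃, h₄, h₅, h₆]
  have h2 : (2 : ZMod 2) = 0 := rfl
  linear_combination (γ (triEdge 0 0) + γ (triEdge 0 1) + γ (triEdge 0 2) + γ (triEdge 1 1) +
    γ (triEdge 1 2) + γ (triEdge 2 2)) * h2

/-- The cohomology class is detected by the sum over the four triangles. If the sum vanishes, a
primitive is given by evaluating the cocycle on the cones over edges. -/
lemma cls_eq_zero_iff (β : NormalizedCocycle (∂Δ[3] : SSet.{0})) :
    β.cls = 0 ↔ ∑ d, facetValue β d = 0 := by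
  have hcls : β.cls = 0 ↔ ∃ α, coboundary (∂Δ[3] : SSet.{0}) 1 α = β.toFun :=
    Submodule.Quotient.mk_eq_zero _
  rw [hcls]
  constructor
  · rintro ⟨α, hα⟩
    refine Eq.trans (Finset.sum_congr rfl fun d _ => ?_) (sum_sum_triEdge fun z => α (tetEdge z))
    rw [facetValue, ← hα, coboundary_apply]
    simp only [δ_facet]
  · refine fun h => ⟨fun x => β (cone x), funext fun x => ?_⟩
    rw [coboundary_apply]
    have h2 : (2 : ZMod 2) = 0 := rfl
    have h01 : x.1 0 ≤ x.1 1 := SSet.stdSimplex.monotone_apply x.1 (by decide)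
    have h12 : x.1 1 ≤ x.1 2 := SSet.stdSimplex.monotone_apply x.1 (by decide)
    let f : Fin 4 →o Fin 4 :=
      ⟨![0, x.1 0, x.1 1, x.1 2], by
        rw [Fin.monotone_iff_le_succ]
        intro l
        fin_cases l
        exacts [Fin.zero_le _, h01, h12]⟩
    by_cases hf : Function.Surjective f
    · have hx : x = facet 0 := by
        have key : ∀ a b c : Fin 4, a ≤ b → b ≤ c → (∀ d, d = 0 ∨ d = a ∨ d = b ∨ d = c) →
            a = 1 ∧ b = 2 ∧ c = 3 := by
          decide
        obtain ⟨h₀, h₁, h₂⟩ := key _ _ _ h01 h12 fun d => by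
          obtain ⟨i, rfl⟩ := hf d
          fin_cases i
          exacts [.inl rfl, .inr (.inl rfl), .inr (.inr (.inl rfl)), .inr (.inr (.inr rfl))]
        refine boundary_simplex_ext fun i => ?_
        fin_cases i
        exacts [h₀, h₁, h₂]
      have hc : ∀ k : Fin 3, cone ((∂Δ[3] : SSet.{0}).δ k (facet 0)) = facet k.succ := by
        intro k
        refine boundary_simplex_ext fun i => ?_
        fin_cases k <;> fin_cases i <;> rfl
      rw [Fin.sum_univ_succ] at h
      rw [hx]
      simp only [hc]
      have h' : β (facet 0) + ∑ k : Fin 3, β (facet k.succ) = 0 := h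
      change _ = β (facet 0)
      linear_combination h' - β (facet 0) * h2
    · let τ : (∂Δ[3] : SSet.{0}) _⦋3⦌ := ⟨SSet.stdSimplex.objMk f, hf⟩
      have hτ := congrFun β.cocycle τ
      rw [coboundary_apply, Fin.sum_univ_succ] at hτ
      have h₀ : (∂Δ[3] : SSet.{0}).δ 0 τ = x := boundary_simplex_ext fun i => by
        fin_cases i <;> rfl
      have hc : ∀ k : Fin 3, (∂Δ[3] : SSet.{0}).δ k.succ τ = cone ((∂Δ[3] : SSet.{0}).δ k x) := by
        intro k
        refine boundary_simplex_ext fun i => ?_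
        fin_cases k <;> fin_cases i <;> rfl
      simp only [hc, h₀] at hτ
      have h' : β x + ∑ k : Fin 3, β (cone ((∂Δ[3] : SSet.{0}).δ k x)) = 0 := hτ
      change _ = β x
      linear_combination h' - β x * h2

/-! ### Counting deterministic edges and triangles -/

/-- The vertices opposite to the deterministic triangles. -/
def detFacets (p : (∂Δ[3] : SSet.{0}) ⟶ distSSet (twistedProduct β)) : Set (Fin 4) :=
  {d | IsDeterministicSimplex p (facet d)}

/-- The pairs of endpoints of the deterministic edges. -/
def detEdges (p : (∂Δ[3] : SSet.{0}) ⟶ distSSet (twistedProduct β)) : Set (Sym2 (Fin 4)) :=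
  {z | ¬ z.IsDiag ∧ expectations p z * expectations p z = 1}

lemma ncard_detSimplices_two (p : (∂Δ[3] : SSet.{0}) ⟶ distSSet (twistedProduct β)) :
    (detSimplices p 2).ncard = (detFacets p).ncard := by
  rw [← Set.ncard_image_of_injective _ facet_injective]
  congr 1
  ext x
  rw [mem_detSimplices_iff (.inr rfl)]
  constructor
  · intro hx
    obtain ⟨d, rfl⟩ := (mem_nonDegenerate_two_iff x).1 hx.1
    exact ⟨d, hx, rfl⟩
  · rintro ⟨d, hd, rfl⟩
    exact hd

lemma ncard_detSimplices_one (hp : p ∈ twistedDist β) :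
    (detSimplices p 1).ncard = (detEdges p).ncard := by
  rw [← Set.ncard_image_of_injective _ tetEdge_injective]
  congr 1
  ext x
  rw [mem_detSimplices_iff (.inl rfl), isDeterministicSimplex_edge_iff hp,
    mem_nonDegenerate_one_iff]
  constructor
  · rintro ⟨⟨z, hz, rfl⟩, h⟩
    exact ⟨z, ⟨hz, h⟩, rfl⟩
  · rintro ⟨z, ⟨hz, h⟩, rfl⟩
    exact ⟨⟨z, hz, rfl⟩, h⟩

lemma triEdge_mem_detEdges {d : Fin 4} (hd : d ∈ detFacets p) (k : Fin 3) :
    triEdge d k ∈ detEdges p := by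
  refine ⟨not_isDiag_triEdge d k, ?_⟩
  rw [expectations, ← δ_facet]
  exact edgeExpect_δ_mul_self hd k

variable {i j k l : Fin 4}

lemma mem_detEdges_of_mem_detFacets (h : Labelling i j k l) (hl : l ∈ detFacets p) :
    s(i, j) ∈ detEdges p := by
  obtain ⟨m, hm⟩ : ∃ m, triEdge l m = s(i, j) := by
    clear hl
    revert i j k l
    decide
  exact hm ▸ triEdge_mem_detEdges hl m

/-- A triangle with two deterministic edges is deterministic. -/
lemma mem_detFacets (hp : p ∈ twistedDist β) (h : Labelling i j k l) (hij : s(i, j) ∈ detEdges p)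
    (hjk : s(j, k) ∈ detEdges p) : l ∈ detFacets p := by
  obtain ⟨m, m', hne, hm, hm'⟩ : ∃ m m', m ≠ m' ∧ triEdge l m = s(i, j) ∧
      triEdge l m' = s(j, k) := by
    clear hij hjk
    revert i j k l
    decide
  refine isDeterministicSimplex_triangle hp ((mem_nonDegenerate_two_iff _).2 ⟨l, rfl⟩) hne ?_ ?_
  · rw [δ_facet, hm]
    exact hij.2
  · rw [δ_facet, hm']
    exact hjk.2

/-- Two deterministic triangles contain five of the six edges, so all four triangles are
deterministic. -/
lemma detFacets_eq_univ (hp : p ∈ twistedDist β) (hk : k ∈ detFacets p) (hl : l ∈ detFacets p)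
    (hkl : k ≠ l) : detFacets p = Set.univ := by
  obtain ⟨i, j, h⟩ : ∃ i j, Labelling i j k l := by
    clear hk hl
    revert k l
    decide
  have hik := mem_detEdges_of_mem_detFacets (p := p) (i := k) (j := i) (k := j) (l := l)
    (by tauto) hl
  have hil := mem_detEdges_of_mem_detFacets (p := p) (i := i) (j := l) (k := j) (l := k)
    (by tauto) hk
  have hjk := mem_detEdges_of_mem_detFacets (p := p) (i := k) (j := j) (k := i) (l := l)
    (by tauto) hl
  have hjl := mem_detEdges_of_mem_detFacets (p := p) (i := j) (j := l) (k := i) (l := k)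
    (by tauto) hk
  refine Set.eq_univ_of_forall fun d => ?_
  obtain rfl | rfl | rfl | rfl := labelling_vertex h d
  · exact mem_detFacets hp (by tauto) hjk hjl
  · exact mem_detFacets hp (by tauto) hik hil
  · exact hk
  · exact hl

lemma detFacets_cases (hp : p ∈ twistedDist β) :
    detFacets p = ∅ ∨ (∃ l, detFacets p = {l}) ∨ detFacets p = Set.univ := by
  obtain h | ⟨l, hl⟩ := (detFacets p).eq_empty_or_nonempty
  · exact .inl h
  by_cases h : ∃ k ∈ detFacets p, k ≠ l
  · obtain ⟨k, hk, hkl⟩ := h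
    exact .inr (.inr (detFacets_eq_univ hp hk hl hkl))
  · push Not at h
    exact .inr (.inl ⟨l, Set.eq_singleton_iff_unique_mem.2 ⟨hl, h⟩⟩)

lemma ncard_univ_fin_four : (Set.univ : Set (Fin 4)).ncard = 4 := by
  rw [Set.ncard_univ, Nat.card_eq_fintype_card, Fintype.card_fin]

lemma delta_injective {Y : SSet.{u}} (n : SimplexCategoryᵒᵖ) :
    Function.Injective ((delta Y).app n) := by
  intro x y h
  have h' : (StdSimplex.single x : StdSimplex ℝ (Y.obj n)) = .single y := h
  have := congrArg (fun P : StdSimplex ℝ (Y.obj n) => P.weights x) h'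
  simp only [StdSimplex.weights_single, Finsupp.single_eq_same] at this
  by_contra hne
  rw [Finsupp.single_eq_of_ne hne] at this
  exact one_ne_zero this

/-- Every simplex lies on a triangle, so `p` takes values in delta distributions once it does so on
the four triangles. -/
lemma isDeterministic_iff (hp : p ∈ twistedDist β) :
    IsDeterministic p ↔ detFacets p = Set.univ := by
  constructor
  · rintro ⟨s, hs, rfl⟩
    refine Set.eq_univ_of_forall fun d => ⟨(mem_nonDegenerate_two_iff _).2 ⟨d, rfl⟩, ?_⟩
    let e : (Fin 2 → ZMod 2) × (∂Δ[3] : SSet.{0}) _⦋2⦌ := s.app (op ⦋2⦌) (facet d)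
    have he : e.2 = facet d := by
      have h := ConcreteCategory.congr_hom (congr_app hs (op ⦋2⦌)) (facet d)
      exact h
    exact ⟨e.1, congrArg ((delta (twistedProduct β)).app (op ⦋2⦌))
      (show e = (e.1, facet d) from Prod.ext rfl he)⟩
  · intro h
    have hex : ∀ {n : SimplexCategoryᵒᵖ} (x : (∂Δ[3] : SSet.{0}).obj n),
        ∃ e, p.app n x = (delta (twistedProduct β)).app n e := by
      intro n x
      obtain ⟨d, θ, rfl⟩ := exists_eq_map_facet x
      obtain ⟨-, a, ha⟩ : d ∈ detFacets p := h ▸ Set.mem_univ d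
      refine ⟨(twistedProduct β).map θ.op (show (twistedProduct β) _⦋2⦌ from (a, facet d)), ?_⟩
      have h₁ := ConcreteCategory.congr_hom (p.naturality θ.op) (facet d)
      have h₂ := ConcreteCategory.congr_hom ((delta (twistedProduct β)).naturality θ.op)
        (show (twistedProduct β) _⦋2⦌ from (a, facet d))
      refine h₁.trans (.trans ?_ h₂.symm)
      exact congrArg ((distSSet (twistedProduct β)).map θ.op) ha
    choose s hs using @hex
    let S : (∂Δ[3] : SSet.{0}) ⟶ twistedProduct β :=
      { app := fun n => ↾(s (n := n))
        naturality := fun n m f => by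
          refine ConcreteCategory.hom_ext _ _ fun x => delta_injective m ?_
          refine (hs _).symm.trans ((ConcreteCategory.congr_hom (p.naturality f) x).trans ?_)
          refine (congrArg ((distSSet (twistedProduct β)).map f) (hs x)).trans ?_
          exact (ConcreteCategory.congr_hom ((delta (twistedProduct β)).naturality f) (s x)).symm }
    have hS : p = S ≫ delta (twistedProduct β) := by
      ext n x
      exact hs x
    refine ⟨S, ?_, hS⟩
    ext n x
    refine delta_injective n ?_
    have h₁ := ConcreteCategory.congr_hom (congr_app (show p ≫ _ = _ from hp) n) x
    refine Eq.trans ?_ h₁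
    have h₂ : (distMap (twistedProj β)).app n ((delta (twistedProduct β)).app n (s x)) =
        (delta _).app n ((twistedProj β).app n (s x)) :=
      StdSimplex.map_single _ _
    exact h₂.symm.trans (congrArg ((distMap (twistedProj β)).app n) (hs x).symm)

lemma ne_one_of_notMem (hij : i ≠ j) (h : s(i, j) ∉ detEdges p) :
    expectations p s(i, j) * expectations p s(i, j) ≠ 1 :=
  fun h' => h ⟨by simpa using hij, h'⟩

lemma isVertex_iff_of_detFacets_eq_empty (hp : p ∈ twistedDist β) (hT : detFacets p = ∅)
    (hS : 2 ≤ (detEdges p).ncard) : IsVertex β p ↔ β.cls ≠ 0 := by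
  rw [isVertex_iff_isRigid hp, Ne, cls_eq_zero_iff]
  have hno : ∀ {i j k : Fin 4}, i ≠ j → i ≠ k → j ≠ k → s(i, j) ∈ detEdges p →
      s(j, k) ∉ detEdges p := by
    intro i j k hij hik hjk h₁ h₂
    obtain ⟨l, hl⟩ : ∃ l, Labelling i j k l := by
      clear h₁ h₂
      revert i j k
      decide
    have := mem_detFacets hp hl h₁ h₂
    rw [hT] at this
    exact this
  obtain ⟨z, hz, z', hz', hne⟩ := (Set.one_lt_ncard (Set.toFinite _)).1 hS
  induction z with | _ i j
  induction z' with | _ k l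
  have hij : i ≠ j := by simpa using hz.1
  have hkl : k ≠ l := by simpa using hz'.1
  have hji : s(j, i) ∈ detEdges p := by rwa [Sym2.eq_swap]
  have hlk : s(l, k) ∈ detEdges p := by rwa [Sym2.eq_swap]
  -- The two edges are disjoint, since two adjacent ones would span a deterministic triangle.
  have hik : i ≠ k := by
    rintro rfl
    exact hno hij.symm (fun h => hne (by rw [h])) hkl hji hz'
  have hil : i ≠ l := by
    rintro rfl
    exact hno hij.symm (fun h => hne (by rw [h, Sym2.eq_swap])) hkl.symm hji hlk
  have hjk : j ≠ k := by
    rintro rfl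
    exact hno hij (fun h => hne (by rw [h, Sym2.eq_swap])) hkl hz hz'
  have hjl : j ≠ l := by
    rintro rfl
    exact hno hij (fun h => hne (by rw [h])) hkl.symm hz hlk
  exact isRigid_iff_of_opposite (feasible_expectations hp) ⟨hij, hik, hil, hjk, hjl, hkl⟩ hz.2 hz'.2
    (ne_one_of_notMem hjk (hno hij hik hjk hz)) (ne_one_of_notMem hjl (hno hij hil hjl hz))
    (ne_one_of_notMem hil (hno hij.symm hjl hil hji))

lemma isVertex_iff_of_detFacets_eq_singleton (hp : p ∈ twistedDist β) (hT : detFacets p = {l}) :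
    IsVertex β p ↔ β.cls ≠ 0 := by
  rw [isVertex_iff_isRigid hp, Ne, cls_eq_zero_iff]
  have hl : l ∈ detFacets p := hT ▸ rfl
  have hmem : ∀ {d}, d ∈ detFacets p → d = l := fun {d} hd => by rwa [hT] at hd
  obtain ⟨i, j, k, h⟩ : ∃ i j k, Labelling i j k l := by
    clear hl hT hmem
    revert l
    decide
  have hij := mem_detEdges_of_mem_detFacets h hl
  have hjk := mem_detEdges_of_mem_detFacets (p := p) (i := j) (j := k) (k := i) (by tauto) hl
  have hik := mem_detEdges_of_mem_detFacets (p := p) (i := i) (j := k) (k := j) (by tauto) hl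
  refine isRigid_iff_of_facet (feasible_expectations hp) h hij.2 hjk.2 hik.2
    (ne_one_of_notMem (by tauto) fun hjl => ?_) (ne_one_of_notMem (by tauto) fun hkl => ?_)
  · have := hmem (mem_detFacets (l := k) hp (by tauto) hij hjl)
    tauto
  · have := hmem (mem_detFacets (l := i) hp (by tauto) hjk hkl)
    tauto

lemma ncard_detFacets_add_two_le (hp : IsVertex β p) :
    (detFacets p).ncard + 2 ≤ (detEdges p).ncard := by
  obtain hT | ⟨l, hT⟩ | hT := detFacets_cases hp.1
  · rw [hT, Set.ncard_empty, zero_add]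
    by_contra hlt
    have hle : (detEdges p).ncard ≤ 1 := by omega
    rw [Set.ncard_le_one (Set.toFinite _)] at hle
    have hr := (isVertex_iff_isRigid hp.1).1 hp
    obtain hS | ⟨e, he⟩ := (detEdges p).eq_empty_or_nonempty
    · refine not_isRigid_of_le_one s(0, 0) (fun z hz h => ?_) hr
      have : z ∈ detEdges p := ⟨hz, h⟩
      rw [hS] at this
      exact this.elim
    · exact not_isRigid_of_le_one e (fun z hz h => hle z ⟨hz, h⟩ e he) hr
  · have hinj : ∀ d, Function.Injective (triEdge d) := by
      unfold Function.Injective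
      decide
    have hsub : Set.range (triEdge l) ⊆ detEdges p := by
      rintro _ ⟨k, rfl⟩
      exact triEdge_mem_detEdges (hT ▸ rfl) k
    have := Set.ncard_le_ncard hsub (Set.toFinite _)
    rw [← Set.image_univ, Set.ncard_image_of_injective _ (hinj l), Set.ncard_univ,
      Nat.card_eq_fintype_card, Fintype.card_fin] at this
    rw [hT, Set.ncard_singleton]
    exact this
  · have hsub : ((Finset.univ.filter fun z : Sym2 (Fin 4) => ¬ z.IsDiag : Finset _) : Set _) ⊆
        detEdges p := by
      intro z hz
      obtain ⟨d, k, rfl⟩ : ∃ d k, triEdge d k = z := by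
        have hz' := (Finset.mem_filter.1 hz).2
        clear hz
        revert z
        decide
      exact triEdge_mem_detEdges (hT ▸ Set.mem_univ d) k
    have := Set.ncard_le_ncard hsub (Set.toFinite _)
    rw [Set.ncard_coe_finset] at this
    rw [hT, ncard_univ_fin_four]
    exact le_trans (by decide) this

end

end SDist

theorem mainTheorem7 (β : SDist.NormalizedCocycle (∂Δ[3] : SSet.{0})) :
    (∀ p ∈ SDist.twistedDist β,
      ((SDist.detSimplices p 2).ncard = 0 ∨ (SDist.detSimplices p 2).ncard = 1 ∨
        (SDist.detSimplices p 2).ncard = 4) ∧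
      ((SDist.detSimplices p 2).ncard = 4 ↔ SDist.IsDeterministic p)) ∧
    (∀ p, SDist.IsVertex β p →
      (SDist.detSimplices p 2).ncard + 2 ≤ (SDist.detSimplices p 1).ncard) ∧
    (∀ p ∈ SDist.twistedDist β, (SDist.detSimplices p 2).ncard = 0 →
      2 ≤ (SDist.detSimplices p 1).ncard → (SDist.IsVertex β p ↔ β.cls ≠ 0)) ∧
    (∀ p ∈ SDist.twistedDist β, (SDist.detSimplices p 2).ncard = 1 →
      (SDist.IsVertex β p ↔ β.cls ≠ 0)) ∧
    (β.cls = 0 → ∀ p, SDist.IsVertex β p → SDist.IsDeterministic p) := by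
  simp only [SDist.ncard_detSimplices_two]
  refine ⟨fun p hp => ?_, fun p hp => ?_, fun p hp h₂ h₁ => ?_, fun p hp h₂ => ?_,
    fun h0 p hp => ?_⟩
  · rw [SDist.isDeterministic_iff hp]
    obtain hT | ⟨l, hT⟩ | hT := SDist.detFacets_cases hp
    · rw [hT, Set.ncard_empty]
      exact ⟨.inl rfl, by simp, fun h => absurd h Set.empty_ne_univ⟩
    · rw [hT, Set.ncard_singleton]
      refine ⟨.inr (.inl rfl), by simp, fun h => ?_⟩
      have := SDist.ncard_univ_fin_four
      rw [← h, Set.ncard_singleton] at this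
      exact this
    · rw [hT, SDist.ncard_univ_fin_four]
      exact ⟨.inr (.inr rfl), fun _ => rfl, fun _ => rfl⟩
  · rw [SDist.ncard_detSimplices_one hp.1]
    exact SDist.ncard_detFacets_add_two_le hp
  · rw [SDist.ncard_detSimplices_one hp] at h₁
    exact SDist.isVertex_iff_of_detFacets_eq_empty hp ((Set.ncard_eq_zero (Set.toFinite _)).1 h₂) h₁
  · obtain ⟨l, hl⟩ := Set.ncard_eq_one.1 h₂
    exact SDist.isVertex_iff_of_detFacets_eq_singleton hp hl
  · -- By the other parts, a vertex with at most one deterministic triangle would force `[β] ≠ 0`.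
    rw [SDist.isDeterministic_iff hp.1]
    obtain hT | ⟨l, hT⟩ | hT := SDist.detFacets_cases hp.1
    · have h := SDist.ncard_detFacets_add_two_le hp
      rw [hT, Set.ncard_empty, zero_add] at h
      exact absurd h0 ((SDist.isVertex_iff_of_detFacets_eq_empty hp.1 hT h).1 hp)
    · exact absurd h0 ((SDist.isVertex_iff_of_detFacets_eq_singleton hp.1 hT).1 hp)
    · exact hT
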